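/- **Notation.** Let $(s)_\nu=\Gamma(s+\nu)/\Gamma(s)$ and let $F(a,b;c;w)$ be the Gauss hypergeometric function, continued analytically to $\mathbb C\setminus[1,\infty)$. For shape parameters $\alpha_1,\alpha_2>0$, values $Y_1,Y_2>0$ and $\nu\in\mathbb C$ put $z=\frac{\alpha_2Y_2}{\alpha_1Y_1}$ and $$\mathscr T_\nu=\frac{\alpha_1-1}{\alpha_1Y_1}\left(F(1,2-\alpha_1;\alpha_2;-z)-\frac{z^\nu}{(\alpha_1-1)_{-\nu}(\alpha_2)_\nu}F(1,2-\alpha_1+\nu;\alpha_2+\nu;-z)\right).$$ For $\ell\in\mathbb N_0$ let $\Phi(z,-\ell,\omega)$ be the analytic continuation of $\sum_{k\ge0}(k+\omega)^{\ell}z^k$ (with $0^0=1$) to $\mathbb C\setminus\{1\}$, and let the incomplete Lerch transcendent be $$\Phi(z,-\ell,\omega)_\nu=\Phi(z,-\ell,\omega)-z^\nu\,\Phi(z,-\ell,\omega+\nu),$$ continued to its removable singularity $z=1$. The Nørlund polynomials $B_k^{(s)}$ are defined by $\left(\frac{t}{e^t-1}\right)^{s}=\sum_{k\ge0}B_k^{(s)}\frac{t^k}{k!}$.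 Put $$P_{2k}(x)=\sum_{m=0}^k\frac{1}{\alpha_1^{m}\alpha_2^{k-m}}\binom{x+1}{m}\binom{-x}{k-m}B_m^{(2+x)}B_{k-m}^{(1-x)},\qquad p_{k,\ell}(\alpha_1,\alpha_2)=\frac{\partial_x^\ell P_{2k}(0)}{\ell!}.$$ **Theorem.** 1. $P_{2k}$ is a polynomial in $x$ of degree at most $2k$, i.e. $P_{2k}(x)=\sum_{\ell=0}^{2k}p_{k,\ell}(\alpha_1,\alpha_2)x^\ell$ for all $x\in\mathbb C$, $k\in\mathbb N_0$ and $\alpha_1,\alpha_2>0$. 2. For all fixed $\nu\in\mathbb C$ and $Y_1,Y_2>0$, as $\alpha_1,\alpha_2\to\infty$ (independently of each other), $$\mathscr T_\nu\sim\frac1{Y_1}\sum_{k=0}^\infty\sum_{\ell=0}^{2k}p_{k,\ell}(\alpha_1,\alpha_2)\,\Phi(Y_2/Y_1,-\ell,0)_\nu ,$$ that is, for every $K\in\mathbb N_0$, $$\mathscr T_\nu-\frac1{Y_1}\sum_{k=0}^{K}\sum_{\ell=0}^{2k}p_{k,\ell}(\alpha_1,\alpha_2)\,\Phi(Y_2/Y_1,-\ell,0)_\nu=O\!\left(\Big(\tfrac1{\alpha_1}+\tfrac1{\alpha_2}\Big)^{K+1}\right).$$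 3. If $\nu=n\in\{1,2,\dots\}$, then for all $\alpha_1,\alpha_2,Y_1,Y_2>0$ with $\alpha_2>n-2$ the expansion converges absolutely as a series in $k$: $$\sum_{k=0}^\infty\left|\frac1{Y_1}\sum_{\ell=0}^{2k}p_{k,\ell}(\alpha_1,\alpha_2)\,\Phi(Y_2/Y_1,-\ell,0)_n\right|<\infty .$$ -/

import Mathlib

open Filter Topology Asymptotics

noncomputable section

namespace GenEstimator

/-- Principle of analytic continuation: `analyticCont U g w` is the value at `w` of the analytic
function on `U` which agrees with `g` near the origin. (It is unique on a connected open set `U`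
containing `0`, see `analyticCont_eq`; the value is `0` if there is no such function.) -/
def analyticCont (U : Set ℂ) (g : ℂ → ℂ) (w : ℂ) : ℂ :=
  open Classical in
  if h : ∃ f : ℂ → ℂ, AnalyticOnNhd ℂ f U ∧ f =ᶠ[𝓝 0] g then h.choose w else 0

theorem analyticCont_eq {U : Set ℂ} (hU : IsPreconnected U) (h0 : (0 : ℂ) ∈ U) {f g : ℂ → ℂ}
    (hf : AnalyticOnNhd ℂ f U) (hfg : f =ᶠ[𝓝 0] g) {w : ℂ} (hw : w ∈ U) :
    analyticCont U g w = f w := by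
  have h : ∃ f : ℂ → ℂ, AnalyticOnNhd ℂ f U ∧ f =ᶠ[𝓝 0] g := ⟨f, hf, hfg⟩
  have hc := h.choose_spec
  unfold analyticCont
  rw [dif_pos h]
  exact hc.1.eqOn_of_preconnected_of_eventuallyEq hf hU h0 (hc.2.trans hfg.symm) hw

/-- The Gauss hypergeometric function `F(a, b; c; w)`: the analytic continuation of the
hypergeometric series to the plane cut along `[1, ∞)`. -/
def hyp2F1 (a b c w : ℂ) : ℂ :=
  analyticCont {u : ℂ | 1 - u ∈ Complex.slitPlane} (fun u => ₂F₁ a b c u) w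

/-- The Pochhammer symbol `(s)_ν = Γ(s + ν) / Γ(s)` with complex index. -/
def cpoch (s ν : ℂ) : ℂ := Complex.Gamma (s + ν) / Complex.Gamma s

/-- The sine-modulated incomplete hypergeometric function
`𝓕(1, β; γ; -z)_ν = F(1, β; γ; -z) - z ^ ν / ((1 - β)_{-ν} (γ)_ν) * F(1, β + ν; γ + ν; -z)`. -/
def incHyp (β γ z ν : ℂ) : ℂ :=
  hyp2F1 1 β γ (-z)
    - z ^ ν / (cpoch (1 - β) (-ν) * cpoch γ ν) * hyp2F1 1 (β + ν) (γ + ν) (-z)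

/-- The generalized estimator `𝒯_ν` with shape parameters `α₁, α₂`, as a function of the
observed values `y₁, y₂` of the two gamma variables. -/
def estimator (ν : ℂ) (α₁ α₂ y₁ y₂ : ℝ) : ℂ :=
  ((α₁ : ℂ) - 1) / (α₁ * y₁) * incHyp (2 - α₁) α₂ (α₂ * y₂ / (α₁ * y₁)) ν

/-- The Lerch transcendent `Φ(z, -ℓ, ω)` of nonpositive integer order: the analytic continuation
of `∑ (k + ω) ^ ℓ z ^ k` to `ℂ \ {1}` (with the convention `0 ^ 0 = 1`). -/
def lerchNeg (z : ℂ) (ℓ : ℕ) (ω : ℂ) : ℂ :=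
  analyticCont {(1 : ℂ)}ᶜ (fun u => ∑' k : ℕ, ((k : ℂ) + ω) ^ ℓ * u ^ k) z

/-- The incomplete Lerch transcendent
`Φ(z, -ℓ, ω)_ν = Φ(z, -ℓ, ω) - z ^ ν Φ(z, -ℓ, ω + ν)`, continued to its removable
singularity `z = 1`. -/
def incLerchNeg (z : ℂ) (ℓ : ℕ) (ω ν : ℂ) : ℂ :=
  open Classical in
  if z = 1 then
    limUnder (𝓝[≠] (1 : ℂ)) fun u => lerchNeg u ℓ ω - u ^ ν * lerchNeg u ℓ (ω + ν)
  else lerchNeg z ℓ ω - z ^ ν * lerchNeg z ℓ (ω + ν)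

/-- The Nørlund polynomial `B_k^{(s)}`, defined by
`(t / (exp t - 1)) ^ s = ∑ B_k^{(s)} t ^ k / k!` near `t = 0`, where the base has the value `1`
at its removable singularity `t = 0` and the power is the principal one. -/
def norlund (k : ℕ) (s : ℂ) : ℂ :=
  iteratedDeriv k (fun t : ℂ => (if t = 0 then 1 else t / (Complex.exp t - 1)) ^ s) 0

/-- The polynomial function `P_{2k}(x)`. -/
def P (α₁ α₂ : ℝ) (k : ℕ) (x : ℂ) : ℂ :=
  ∑ m ∈ Finset.range (k + 1),
    1 / ((α₁ : ℂ) ^ m * (α₂ : ℂ) ^ (k - m))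
      * Ring.choose (x + 1) m * Ring.choose (-x) (k - m)
      * norlund m (2 + x) * norlund (k - m) (1 - x)

/-- The coefficient `p_{k,ℓ}(α₁, α₂) = ∂_x^ℓ P_{2k}(0) / ℓ!`. -/
def pCoeff (α₁ α₂ : ℝ) (k ℓ : ℕ) : ℂ :=
  iteratedDeriv ℓ (P α₁ α₂ k) 0 / (ℓ.factorial : ℂ)

/-- The `k`-th term
`(1 / y₁) ∑_{ℓ ≤ 2k} p_{k,ℓ}(α₁, α₂) Φ(y₂ / y₁, -ℓ, 0)_ν` of the expansion. -/
def expansionTerm (ν : ℂ) (α₁ α₂ y₁ y₂ : ℝ) (k : ℕ) : ℂ :=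
  1 / (y₁ : ℂ) * ∑ ℓ ∈ Finset.range (2 * k + 1),
    pCoeff α₁ α₂ k ℓ * incLerchNeg ((y₂ : ℂ) / y₁) ℓ 0 ν

end GenEstimator

end

/-! Write v = Y₂/Y₁, ε = 1/α₁ + 1/α₂ and g(x) = `gammaRatio α₁ (-1 - x) * gammaRatio α₂ x`. Because
one upper parameter is 1, the hypergeometric equation reduces to a first-order inhomogeneous linear
equation. Hence `estFun`, which is Y₁ times the estimator as a function of v, solves such an
equation, and its right side involves Gamma functions only through g(0) and g(ν) v^ν
(`exists_hasDerivAt_estFun`).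

The functional equation of Γ gives (1 + x/α₂) g(x+1) = (1 - (x+2)/α₁) g(x). The P_{2k}(x) are the
homogeneous components of the formal expansion of g(x) in 1/α₁ and 1/α₂, so their partial sums S
obey the same recurrence up to a defect of order ε^(K+1) (`partialSum_recurrence`). The truncated
expansion is S(v d/dv) applied to (1 - v^ν)/(1 - v), and shifting S by one amounts to dividing by v,
up to the boundary terms S(0) and S(ν) v^ν (`lerchOp_comp_X_add_one`). It therefore solves the
equation of the estimator with g replaced by S, up to a small term (`hasDerivAt_lerchOp_sum`). By
Watson's lemma g - S is O(ε^(K+1)) at 0 and at ν (`gammaRatio_mul_isBigO`).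

The difference Δ is controlled with an integrating factor W. The product WΔ vanishes at both ends;
at ∞ this holds because the normalization of the second term of 𝒯_ν cancels the growing solution.
Since W peaks near v = 1, integrating from 0 when v ≤ 1 and from ∞ when v ≥ 1 gives a bound uniform
in the shape parameters (`norm_le_of_ode`). It costs one power of ε, which is regained by keeping
one more term (`estimator_sub_isBigO`).

For ν = n the operator only evaluates S at j = 0, ..., n-1. There the P_{2k}(j) are the coefficients
of a polynomial times finitely many geometric series, which converge absolutely when j - 1 < α₂. -/

noncomputable section

namespace GenEstimator

section

/-! ### Nørlund polynomials -/

/-- The function `t / (exp t - 1)`, with value `1` at `t = 0`. -/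
def nBase (t : ℂ) : ℂ := if t = 0 then 1 else t / (Complex.exp t - 1)

theorem nBase_eq_inv_dslope (t : ℂ) : nBase t = (dslope Complex.exp 0 t)⁻¹ := by
  unfold nBase
  split_ifs with h
  · subst h; simp [dslope_same]
  · rw [dslope_of_ne _ h, slope_def_field]; simp

theorem nBase_zero : nBase 0 = 1 := by simp [nBase]

theorem differentiable_dslope_exp : Differentiable ℂ (dslope Complex.exp 0) := by
  rw [← differentiableOn_univ, Complex.differentiableOn_dslope Filter.univ_mem]
  exact Complex.differentiable_exp.differentiableOn

theorem analyticAt_nBase : AnalyticAt ℂ nBase 0 := by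
  rw [show nBase = fun t => (dslope Complex.exp 0 t)⁻¹ from funext nBase_eq_inv_dslope]
  refine (differentiable_dslope_exp.analyticAt 0).inv ?_
  simp [dslope_same]

theorem eventually_nBase_mem_slitPlane : ∀ᶠ t in 𝓝 (0 : ℂ), nBase t ∈ Complex.slitPlane := by
  refine analyticAt_nBase.continuousAt.eventually_mem (Complex.isOpen_slitPlane.mem_nhds ?_)
  simp [nBase_zero]

theorem eventually_nBase_mul : ∀ᶠ t in 𝓝 (0 : ℂ), nBase t * (Complex.exp t - 1) = t := by
  filter_upwards [eventually_nBase_mem_slitPlane] with t ht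
  have h0 := Complex.slitPlane_ne_zero ht
  by_cases h : t = 0
  · simp [h]
  · have : Complex.exp t - 1 ≠ 0 := by
      intro h1
      simp [nBase, h, h1] at h0
    simp [nBase, h, this]

/-- Differentiating `nBase t * (exp t - 1) = t` and eliminating the exponential leaves a Riccati
equation. Its quadratic term is what raises the exponent in `eventually_mul_deriv_nPow`. -/
theorem eventually_mul_deriv_nBase :
    ∀ᶠ t in 𝓝 (0 : ℂ), t * deriv nBase t = nBase t * (1 - nBase t - t) := by
  filter_upwards [eventually_nBase_mul.eventually_nhds, analyticAt_nBase.eventually_analyticAt]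
    with t ht hd
  have h1 : HasDerivAt (fun t => nBase t * (Complex.exp t - 1))
      (deriv nBase t * (Complex.exp t - 1) + nBase t * Complex.exp t) t :=
    hd.differentiableAt.hasDerivAt.mul ((Complex.hasDerivAt_exp t).sub_const 1)
  have h2 := (h1.congr_of_eventuallyEq (ht.mono fun _ h => h.symm)).unique (hasDerivAt_id t)
  have h3 := ht.self_of_nhds
  linear_combination nBase t * h2 - (deriv nBase t + nBase t) * h3

/-- The function whose Taylor coefficients at `0` are the Nørlund polynomials. -/
def nPow (s t : ℂ) : ℂ := nBase t ^ s

theorem norlund_eq (k : ℕ) (s : ℂ) : norlund k s = iteratedDeriv k (nPow s) 0 := rfl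

theorem analyticAt_nPow (s : ℂ) : AnalyticAt ℂ (nPow s) 0 :=
  analyticAt_nBase.cpow analyticAt_const (by simp [nBase_zero])

theorem eventually_deriv_nPow (s : ℂ) :
    ∀ᶠ t in 𝓝 (0 : ℂ), deriv (nPow s) t = s * (deriv nBase t / nBase t * nPow s t) := by
  filter_upwards [eventually_nBase_mem_slitPlane, analyticAt_nBase.eventually_analyticAt]
    with t ht hd
  have h1 : HasDerivAt (nPow s) _ t := hd.differentiableAt.hasDerivAt.cpow_const (c := s) ht
  have h0 := Complex.slitPlane_ne_zero ht
  rw [h1.deriv, Complex.cpow_sub _ _ h0, Complex.cpow_one, nPow]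
  field_simp

theorem eventually_mul_deriv_nPow (s : ℂ) : ∀ᶠ t in 𝓝 (0 : ℂ),
    t * deriv (nPow s) t = s * nPow s t - s * (t * nPow s t) - s * nPow (s + 1) t := by
  filter_upwards [eventually_deriv_nPow s, eventually_mul_deriv_nBase,
    eventually_nBase_mem_slitPlane] with t h1 h2 ht
  have h0 := Complex.slitPlane_ne_zero ht
  have h3 : nPow (s + 1) t = nPow s t * nBase t := by
    simp [nPow, Complex.cpow_add _ _ h0]
  rw [h1, h3, show t * (s * (deriv nBase t / nBase t * nPow s t))
    = s * (t * deriv nBase t / nBase t * nPow s t) by ring, h2]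
  field_simp
  ring

theorem iteratedDeriv_id_mul_zero {f : ℂ → ℂ} (hf : AnalyticAt ℂ f 0) (k : ℕ) :
    iteratedDeriv k (fun t => t * f t) 0 = k * iteratedDeriv (k - 1) f 0 := by
  rw [iteratedDeriv_fun_mul (f := fun t : ℂ => t) contDiffAt_id hf.contDiffAt]
  simp_rw [iteratedDeriv_fun_id_zero]
  rcases k with _ | k
  · simp
  · rw [Finset.sum_eq_single 1]
    · simp
    · intro b _ hb; simp [hb]
    · intro h; simp at h

theorem norlund_zero (s : ℂ) : norlund 0 s = 1 := by
  simp [norlund_eq, nPow, nBase_zero]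

theorem norlund_order_zero (k : ℕ) : norlund k 0 = if k = 0 then 1 else 0 := by
  have : nPow 0 = fun _ => 1 := by ext; simp [nPow]
  rw [norlund_eq, this, iteratedDeriv_const]

/-- Leibniz's rule for the logarithmic derivative. The inner coefficients do not depend on `s`, so
the single prefactor `s` makes the degree grow by at most one per step. -/
theorem norlund_succ (k : ℕ) (s : ℂ) :
    norlund (k + 1) s = s * ∑ i ∈ Finset.range (k + 1), (k.choose i : ℂ)
      * iteratedDeriv i (fun t => deriv nBase t / nBase t) 0 * norlund (k - i) s := by
  have ha : AnalyticAt ℂ (fun t => deriv nBase t / nBase t) 0 :=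
    analyticAt_nBase.deriv.div analyticAt_nBase (by simp [nBase_zero])
  rw [norlund_eq, iteratedDeriv_succ', Filter.EventuallyEq.iteratedDeriv_eq k (eventually_deriv_nPow s),
    iteratedDeriv_const_mul_field, iteratedDeriv_fun_mul ha.contDiffAt
      (analyticAt_nPow s).contDiffAt]
  rfl

/-- Taylor coefficients of `eventually_mul_deriv_nPow`. At `k = 0` the truncated index `k - 1` is
harmless, its term being multiplied by `k`. -/
theorem norlund_add_one (k : ℕ) (s : ℂ) :
    s * norlund k (s + 1) = (s - k) * norlund k s - s * k * norlund (k - 1) s := by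
  have h := Filter.EventuallyEq.iteratedDeriv_eq k (eventually_mul_deriv_nPow s)
  have hN := analyticAt_nPow s
  have hN1 := analyticAt_nPow (s + 1)
  have hid : AnalyticAt ℂ (fun t : ℂ => t) 0 := analyticAt_id
  rw [iteratedDeriv_id_mul_zero hN.deriv, ← Pi.sub_def, ← Pi.sub_def, iteratedDeriv_sub,
    iteratedDeriv_sub, iteratedDeriv_const_mul_field, iteratedDeriv_const_mul_field,
    iteratedDeriv_const_mul_field, iteratedDeriv_id_mul_zero hN] at h
  · rcases k with _ | k
    · simp [norlund_zero]
    · rw [Nat.add_sub_cancel, ← iteratedDeriv_succ'] at h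
      simp only [← norlund_eq] at h
      rw [Nat.add_sub_cancel]
      linear_combination h
  · exact (analyticAt_const.mul hN).contDiffAt
  · exact (analyticAt_const.mul (hid.mul hN)).contDiffAt
  · exact ((analyticAt_const.mul hN).sub (analyticAt_const.mul (hid.mul hN))).contDiffAt
  · exact (analyticAt_const.mul hN1).contDiffAt

open Polynomial in
theorem exists_norlund_polynomial (k : ℕ) :
    ∃ Q : ℂ[X], Q.natDegree ≤ k ∧ ∀ s, Q.eval s = norlund k s := by
  induction k using Nat.strong_induction_on with
  | _ k ih =>
    rcases k with _ | k
    · exact ⟨1, by simp, fun s => by simp [norlund_zero]⟩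
    -- The bound on `j` is moved under the existential, with a dummy `0` outside the range, so that
    -- `choose` yields a total family.
    · have ih' : ∀ j, ∃ Q : ℂ[X], j < k + 1 → Q.natDegree ≤ j ∧ ∀ s, Q.eval s = norlund j s := by
        intro j
        by_cases hj : j < k + 1
        · obtain ⟨Q, hQ⟩ := ih j hj
          exact ⟨Q, fun _ => hQ⟩
        · exact ⟨0, fun h => absurd h hj⟩
      choose Q hQ using ih'
      refine ⟨X * ∑ i ∈ Finset.range (k + 1), C ((k.choose i : ℂ)
        * iteratedDeriv i (fun t => deriv nBase t / nBase t) 0) * Q (k - i), ?_, fun s => ?_⟩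
      · refine natDegree_mul_le.trans ?_
        rw [natDegree_X, add_comm]
        gcongr
        refine natDegree_sum_le_of_forall_le _ _ fun i hi => ?_
        refine (natDegree_C_mul_le _ _).trans (((hQ (k - i) (by omega)).1).trans (by omega))
      · rw [norlund_succ, eval_mul, eval_X, eval_finsetSum]
        congr 1
        refine Finset.sum_congr rfl fun i hi => ?_
        rw [eval_mul, eval_C, (hQ (k - i) (by omega)).2]

/-! ### The coefficients of the expansion of a ratio of Gamma functions -/

/-- The coefficients in `Γ(α) α ^ x / Γ(α + x) ∼ ∑ ratioCoeff k x α ^ (-k)`. -/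
def ratioCoeff (k : ℕ) (x : ℂ) : ℂ := Ring.choose (-x) k * norlund k (1 - x)

open Polynomial in
theorem ring_choose_eq_eval (k : ℕ) (x : ℂ) :
    Ring.choose x k = (C ((k.factorial : ℂ)⁻¹) * descPochhammer ℂ k).eval x := by
  rw [Ring.choose_eq_smul, eval_mul, eval_C, smul_eq_mul,
    Polynomial.descPochhammer_smeval_eq_ascPochhammer, Polynomial.ascPochhammer_smeval_eq_eval,
    descPochhammer_eval_eq_ascPochhammer]

theorem mul_ring_choose_sub_one (k : ℕ) (x : ℂ) :
    x * Ring.choose (x - 1) k = (x - k) * Ring.choose x k := by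
  rw [ring_choose_eq_eval, ring_choose_eq_eval]
  simp only [Polynomial.eval_mul, Polynomial.eval_C]
  have h1 := descPochhammer_succ_eval k x
  have h2 : (descPochhammer ℂ (k + 1)).eval x = x * (descPochhammer ℂ k).eval (x - 1) := by
    rw [descPochhammer_succ_left]; simp
  linear_combination (-(k.factorial : ℂ)⁻¹) * h2 + (k.factorial : ℂ)⁻¹ * h1

theorem succ_mul_ring_choose_succ (k : ℕ) (x : ℂ) :
    (k + 1 : ℂ) * Ring.choose x (k + 1) = x * Ring.choose (x - 1) k := by
  rw [ring_choose_eq_eval, ring_choose_eq_eval]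
  simp only [Polynomial.eval_mul, Polynomial.eval_C]
  have h2 : (descPochhammer ℂ (k + 1)).eval x = x * (descPochhammer ℂ k).eval (x - 1) := by
    rw [descPochhammer_succ_left]; simp
  rw [h2, Nat.factorial_succ]
  have : (k.factorial : ℂ) ≠ 0 := by exact_mod_cast k.factorial_ne_zero
  have : (k + 1 : ℂ) ≠ 0 := by exact_mod_cast k.succ_ne_zero
  push_cast
  field_simp

theorem ratioCoeff_zero_left (x : ℂ) : ratioCoeff 0 x = 1 := by
  simp [ratioCoeff, norlund_zero]

theorem ratioCoeff_zero_right (k : ℕ) : ratioCoeff k 0 = if k = 0 then 1 else 0 := by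
  rcases k with _ | k
  · simp [ratioCoeff_zero_left]
  · simp [ratioCoeff]

/-- Coefficientwise form of Γ(α)α^x/Γ(α+x) = (1 + x/α) Γ(α)α^(x+1)/Γ(α+x+1). The case `x = 0` is
separate because the argument cancels a factor `-x`. -/
theorem ratioCoeff_succ (k : ℕ) (x : ℂ) :
    ratioCoeff (k + 1) x = ratioCoeff (k + 1) (x + 1) + x * ratioCoeff k (x + 1) := by
  by_cases hx : x = 0
  · subst hx
    simp [ratioCoeff, norlund_order_zero]
  · have h1 := norlund_add_one (k + 1) (-x)
    have h2 := mul_ring_choose_sub_one (k + 1) (-x)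
    have h3 := succ_mul_ring_choose_succ k (-x)
    simp only [ratioCoeff]
    rw [show 1 - x = -x + 1 by ring, show 1 - (x + 1) = -x by ring,
      show -(x + 1) = -x - 1 by ring]
    rw [Nat.add_sub_cancel] at h1
    push_cast at h1 h2
    refine mul_left_cancel₀ (neg_ne_zero.mpr hx) ?_
    linear_combination Ring.choose (-x) (k + 1) * h1 - norlund (k + 1) (-x) * h2
      + x * norlund k (-x) * h3

open Polynomial in
theorem exists_ratioCoeff_polynomial (k : ℕ) :
    ∃ Q : ℂ[X], Q.natDegree ≤ 2 * k ∧ ∀ x, Q.eval x = ratioCoeff k x := by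
  obtain ⟨Q, hQ, hQ'⟩ := exists_norlund_polynomial k
  refine ⟨(C ((k.factorial : ℂ)⁻¹) * descPochhammer ℂ k).comp (-X) * Q.comp (1 - X), ?_,
    fun x => ?_⟩
  · refine natDegree_mul_le.trans ?_
    rw [natDegree_comp, natDegree_comp, two_mul]
    have h1 : (1 - X : ℂ[X]).natDegree = 1 := by
      rw [← natDegree_neg, neg_sub]; exact natDegree_X_sub_C 1
    rw [natDegree_neg, natDegree_X, h1, mul_one, mul_one]
    exact add_le_add ((natDegree_C_mul_le _ _).trans (descPochhammer_natDegree ℂ k).le) hQ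
  · rw [ratioCoeff, ring_choose_eq_eval, ← hQ']
    simp [eval_comp]

end

section

/-! ### The polynomials `P_{2k}` -/

open Polynomial

/-- `ratioCoeff k` as a polynomial. -/
def ratioPoly (k : ℕ) : ℂ[X] := (exists_ratioCoeff_polynomial k).choose

theorem natDegree_ratioPoly (k : ℕ) : (ratioPoly k).natDegree ≤ 2 * k :=
  (exists_ratioCoeff_polynomial k).choose_spec.1

theorem eval_ratioPoly (k : ℕ) (x : ℂ) : (ratioPoly k).eval x = ratioCoeff k x :=
  (exists_ratioCoeff_polynomial k).choose_spec.2 x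

/-- The bihomogeneous components of `P_{2k}`, without their weights. -/
def pairPoly (i j : ℕ) : ℂ[X] := (ratioPoly i).comp (-1 - X) * ratioPoly j

theorem eval_pairPoly (i j : ℕ) (x : ℂ) :
    (pairPoly i j).eval x = ratioCoeff i (-1 - x) * ratioCoeff j x := by
  simp [pairPoly, eval_ratioPoly]

theorem natDegree_pairPoly (i j : ℕ) : (pairPoly i j).natDegree ≤ 2 * (i + j) := by
  refine natDegree_mul_le.trans ?_
  have h1 : (-1 - X : ℂ[X]).natDegree = 1 := by
    rw [← natDegree_neg, neg_sub, sub_neg_eq_add]; exact natDegree_X_add_C 1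
  rw [natDegree_comp, h1, mul_one, mul_add]
  exact add_le_add (natDegree_ratioPoly i) (natDegree_ratioPoly j)

/-- The function `P_{2k}` as a polynomial. -/
def pPoly (α₁ α₂ : ℝ) (k : ℕ) : ℂ[X] :=
  ∑ m ∈ Finset.range (k + 1), C (1 / ((α₁ : ℂ) ^ m * (α₂ : ℂ) ^ (k - m))) * pairPoly m (k - m)

theorem P_eq_eval (α₁ α₂ : ℝ) (k : ℕ) (x : ℂ) : P α₁ α₂ k x = (pPoly α₁ α₂ k).eval x := by
  rw [P, pPoly, eval_finsetSum]
  refine Finset.sum_congr rfl fun m _ => ?_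
  rw [eval_mul, eval_C, eval_pairPoly, ratioCoeff, ratioCoeff]
  ring_nf

theorem natDegree_pPoly (α₁ α₂ : ℝ) (k : ℕ) : (pPoly α₁ α₂ k).natDegree ≤ 2 * k := by
  refine natDegree_sum_le_of_forall_le _ _ fun m hm => ?_
  have := Finset.mem_range.mp hm
  exact (natDegree_C_mul_le _ _).trans ((natDegree_pairPoly _ _).trans (by omega))

theorem iteratedDeriv_eval (Q : ℂ[X]) (k : ℕ) :
    iteratedDeriv k (fun x => Q.eval x) = fun x => (derivative^[k] Q).eval x := by
  induction k with
  | zero => simp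
  | succ k ih =>
    rw [iteratedDeriv_succ, ih, Function.iterate_succ_apply']
    ext x
    exact Polynomial.deriv _

theorem pCoeff_eq_coeff (α₁ α₂ : ℝ) (k ℓ : ℕ) : pCoeff α₁ α₂ k ℓ = (pPoly α₁ α₂ k).coeff ℓ := by
  rw [pCoeff, show P α₁ α₂ k = fun x => (pPoly α₁ α₂ k).eval x from funext (P_eq_eval α₁ α₂ k),
    iteratedDeriv_eval]
  simp only [← coeff_zero_eq_eval_zero, coeff_iterate_derivative, zero_add,
    Nat.descFactorial_self, nsmul_eq_mul]
  field_simp [show (ℓ.factorial : ℂ) ≠ 0 from by exact_mod_cast ℓ.factorial_ne_zero]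

theorem P_eq_sum (α₁ α₂ : ℝ) (k : ℕ) (x : ℂ) :
    P α₁ α₂ k x = ∑ ℓ ∈ Finset.range (2 * k + 1), pCoeff α₁ α₂ k ℓ * x ^ ℓ := by
  simp_rw [P_eq_eval, pCoeff_eq_coeff]
  exact eval_eq_sum_range' (Nat.lt_succ_of_le (natDegree_pPoly α₁ α₂ k)) x

/-- The formal expansion of the ratio of Gamma functions, with `τ` in place of `1 / α`. -/
def ratioSeries (τ x : ℂ) : PowerSeries ℂ := PowerSeries.mk fun k => τ ^ k * ratioCoeff k x

theorem ratioSeries_eq (τ x : ℂ) :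
    ratioSeries τ x = (1 + PowerSeries.C (x * τ) * PowerSeries.X) * ratioSeries τ (x + 1) := by
  ext k
  rw [add_mul, one_mul, map_add, mul_assoc, PowerSeries.coeff_C_mul]
  rcases k with _ | k
  · simp [ratioSeries, ratioCoeff_zero_left]
  · rw [PowerSeries.coeff_succ_X_mul]
    simp only [ratioSeries, PowerSeries.coeff_mk]
    rw [ratioCoeff_succ]
    ring

theorem eval_pPoly (α₁ α₂ : ℝ) (k : ℕ) (x : ℂ) : (pPoly α₁ α₂ k).eval x
    = PowerSeries.coeff k (ratioSeries (1 / α₁) (-1 - x) * ratioSeries (1 / α₂) x) := by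
  rw [PowerSeries.coeff_mul, Finset.Nat.sum_antidiagonal_eq_sum_range_succ_mk, pPoly,
    eval_finsetSum]
  refine Finset.sum_congr rfl fun m _ => ?_
  simp only [ratioSeries, PowerSeries.coeff_mk, eval_mul, eval_C, eval_pairPoly, one_div, mul_inv,
    inv_pow]
  ring

theorem eval_pPoly_zero (α₁ α₂ : ℝ) (x : ℂ) : (pPoly α₁ α₂ 0).eval x = 1 := by
  simp [pPoly, eval_pairPoly, ratioCoeff_zero_left]

/-- Formal counterpart of (1 + x/α₂) g(x+1) = (1 - (x+2)/α₁) g(x): each Gamma ratio contributes one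
functional equation, and coefficients of order `k + 1` are compared. -/
theorem eval_pPoly_succ (α₁ α₂ : ℝ) (k : ℕ) (x : ℂ) :
    (pPoly α₁ α₂ (k + 1)).eval (x + 1) + x / α₂ * (pPoly α₁ α₂ k).eval (x + 1)
      = (pPoly α₁ α₂ (k + 1)).eval x - (x + 2) / α₁ * (pPoly α₁ α₂ k).eval x := by
  have h : (1 + PowerSeries.C (x * (1 / α₂)) * PowerSeries.X) *
        (ratioSeries (1 / α₁) (-1 - (x + 1)) * ratioSeries (1 / α₂) (x + 1))
      = (1 + PowerSeries.C ((-1 - (x + 1)) * (1 / α₁)) * PowerSeries.X) *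
        (ratioSeries (1 / α₁) (-1 - x) * ratioSeries (1 / α₂) x) := by
    rw [ratioSeries_eq (1 / α₂) x, ratioSeries_eq (1 / α₁) (-1 - (x + 1)),
      show -1 - (x + 1) + 1 = -1 - x by ring]
    ring
  have h' := congrArg (PowerSeries.coeff (k + 1)) h
  simp only [add_mul, one_mul, map_add, mul_assoc, PowerSeries.coeff_C_mul,
    PowerSeries.coeff_succ_X_mul, ← eval_pPoly] at h'
  linear_combination h'

/-- The defect of `∑_{j ≤ k} P_{2j}` in the recurrence of the weights. -/
def defectPoly (α₁ α₂ : ℝ) (k : ℕ) : ℂ[X] :=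
  C (1 / (α₂ : ℂ)) * (X * (pPoly α₁ α₂ k).comp (X + 1))
    + C (1 / (α₁ : ℂ)) * ((X + 2) * pPoly α₁ α₂ k)

/-- Summing `eval_pPoly_succ` over the orders telescopes; only the last index, multiplied by a
further 1/α₁ or 1/α₂, survives the truncation. -/
theorem partialSum_recurrence (α₁ α₂ : ℝ) (K : ℕ) :
    (1 + C (1 / (α₂ : ℂ)) * X) * (∑ k ∈ Finset.range (K + 1), pPoly α₁ α₂ k).comp (X + 1)
      = (1 - C (1 / (α₁ : ℂ)) * (X + 2)) * (∑ k ∈ Finset.range (K + 1), pPoly α₁ α₂ k)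
        + defectPoly α₁ α₂ K := by
  induction K with
  | zero =>
    refine Polynomial.funext fun x => ?_
    simp [defectPoly, eval_pPoly_zero]
  | succ K ih =>
    refine Polynomial.funext fun x => ?_
    have h1 := congrArg (eval x) ih
    have h2 := eval_pPoly_succ α₁ α₂ K x
    rw [Finset.sum_range_succ]
    simp only [defectPoly, eval_add, eval_mul, eval_sub, eval_comp, eval_C, eval_X, eval_one,
      eval_ofNat] at h1 h2 ⊢
    linear_combination h1 + h2

end

section

/-! ### The incomplete Lerch transcendent -/

/-- Taylor series of an analytic function at `0`. -/
theorem eventually_hasSum_of_iteratedDeriv {f : ℂ → ℂ} (hf : AnalyticAt ℂ f 0) {a : ℕ → ℂ}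
    (ha : ∀ k, iteratedDeriv k f 0 = k.factorial * a k) :
    ∀ᶠ u in 𝓝 (0 : ℂ), HasSum (fun k => a k * u ^ k) (f u) := by
  filter_upwards [hf.hasFPowerSeriesAt.eventually_hasSum] with u hu
  rw [zero_add] at hu
  refine hu.congr_fun fun k => ?_
  have : (k.factorial : ℂ) ≠ 0 := by exact_mod_cast k.factorial_ne_zero
  rw [FormalMultilinearSeries.ofScalars_apply_eq, smul_eq_mul, ha]
  field_simp

/-- The rational function continuing `∑ (k + ω) ^ ℓ u ^ k`. -/
def lerchRat (ω : ℂ) : ℕ → ℂ → ℂ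
  | 0 => fun u => (1 - u)⁻¹
  | ℓ + 1 => fun u => ω * lerchRat ω ℓ u + u * deriv (lerchRat ω ℓ) u

theorem analyticOnNhd_lerchRat (ω : ℂ) (ℓ : ℕ) : AnalyticOnNhd ℂ (lerchRat ω ℓ) {1}ᶜ := by
  induction ℓ with
  | zero =>
    intro u hu
    exact (analyticAt_const.sub analyticAt_id).inv (sub_ne_zero.mpr (Ne.symm hu))
  | succ ℓ ih =>
    exact fun u hu => (analyticAt_const.mul (ih u hu)).add (analyticAt_id.mul (ih u hu).deriv)

/-- The operator ω + u d/du multiplies the k-th Taylor coefficient by k + ω, and `lerchRat` iterates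
this operator on the geometric series. -/
theorem iteratedDeriv_lerchRat (ω : ℂ) (ℓ k : ℕ) :
    iteratedDeriv k (lerchRat ω ℓ) 0 = k.factorial * ((k : ℂ) + ω) ^ ℓ := by
  have ha : ∀ ℓ, AnalyticAt ℂ (lerchRat ω ℓ) 0 := fun ℓ =>
    analyticOnNhd_lerchRat ω ℓ 0 (by simp)
  induction ℓ generalizing k with
  | zero =>
    have h1 : (fun u => lerchRat ω 0 u - u * lerchRat ω 0 u) =ᶠ[𝓝 0] fun _ => 1 := by
      filter_upwards [isOpen_ne.mem_nhds (zero_ne_one (α := ℂ))] with u hu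
      have : 1 - u ≠ 0 := sub_ne_zero.mpr (Ne.symm hu)
      simp only [lerchRat]
      field_simp
    have h2 : ∀ k, iteratedDeriv k (lerchRat ω 0) 0 - k * iteratedDeriv (k - 1) (lerchRat ω 0) 0
        = if k = 0 then 1 else 0 := by
      intro k
      have h := h1.iteratedDeriv_eq k
      have hm : AnalyticAt ℂ (fun u => u * lerchRat ω 0 u) 0 := analyticAt_id.mul (ha 0)
      rw [← Pi.sub_def, iteratedDeriv_sub (ha 0).contDiffAt hm.contDiffAt,
        iteratedDeriv_id_mul_zero (ha 0), iteratedDeriv_const] at h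
      exact h
    induction k with
    | zero => simpa using h2 0
    | succ k ih =>
      have h := h2 (k + 1)
      rw [Nat.add_sub_cancel, ih] at h
      rw [Nat.factorial_succ]
      simp only [Nat.add_eq_zero_iff, one_ne_zero, and_false, if_false, pow_zero] at h ⊢
      push_cast at h ⊢
      linear_combination h
  | succ ℓ ih =>
    have hd : AnalyticAt ℂ (fun u => u * deriv (lerchRat ω ℓ) u) 0 := analyticAt_id.mul (ha ℓ).deriv
    have hc : AnalyticAt ℂ (fun u => ω * lerchRat ω ℓ u) 0 := analyticAt_const.mul (ha ℓ)
    rw [show lerchRat ω (ℓ + 1) = (fun u => ω * lerchRat ω ℓ u)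
        + fun u => u * deriv (lerchRat ω ℓ) u from rfl,
      iteratedDeriv_add hc.contDiffAt hd.contDiffAt, iteratedDeriv_const_mul_field,
      iteratedDeriv_id_mul_zero (ha ℓ).deriv, ← iteratedDeriv_succ']
    rcases k with _ | k
    · simp only [CharP.cast_eq_zero, zero_mul, add_zero, ih]; ring
    · rw [Nat.add_sub_cancel, ih]; ring

theorem lerchNeg_eq (z : ℂ) (hz : z ≠ 1) (ℓ : ℕ) (ω : ℂ) : lerchNeg z ℓ ω = lerchRat ω ℓ z := by
  refine analyticCont_eq ?_ (by simp) (analyticOnNhd_lerchRat ω ℓ) ?_ hz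
  · exact (isConnected_compl_singleton_of_one_lt_rank (by simp) 1).isPreconnected
  · filter_upwards [eventually_hasSum_of_iteratedDeriv
      (analyticOnNhd_lerchRat ω ℓ 0 (by simp)) (iteratedDeriv_lerchRat ω ℓ)] with u hu
    exact hu.tsum_eq.symm

/-- The functions `(w d/dw) ^ ℓ ((1 - w ^ ν) / (1 - w))`. -/
def phi (ν : ℂ) : ℕ → ℂ → ℂ
  | 0 => dslope (fun w => w ^ ν) 1
  | ℓ + 1 => fun w => w * deriv (phi ν ℓ) w

theorem differentiableOn_phi (ν : ℂ) (ℓ : ℕ) : DifferentiableOn ℂ (phi ν ℓ) Complex.slitPlane := by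
  induction ℓ with
  | zero =>
    rw [phi, Complex.differentiableOn_dslope (Complex.isOpen_slitPlane.mem_nhds (by simp))]
    exact fun w hw => (differentiableAt_id.cpow_const (c := ν) hw).differentiableWithinAt
  | succ ℓ ih =>
    exact differentiableOn_id.mul (ih.deriv Complex.isOpen_slitPlane)

theorem differentiableAt_phi (ν : ℂ) (ℓ : ℕ) {w : ℂ} (hw : w ∈ Complex.slitPlane) :
    DifferentiableAt ℂ (phi ν ℓ) w :=
  (differentiableOn_phi ν ℓ).differentiableAt (Complex.isOpen_slitPlane.mem_nhds hw)

theorem sub_one_mul_phi_zero (ν w : ℂ) : (w - 1) * phi ν 0 w = w ^ ν - 1 := by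
  simpa [phi] using sub_smul_dslope (fun w : ℂ => w ^ ν) 1 w

/-- Conjugation by w^ν turns w d/dw into ν + w d/dw, which is the recursion of `lerchRat ν`. -/
theorem phi_eq_lerchRat (ν : ℂ) (ℓ : ℕ) {w : ℂ} (hw : w ∈ Complex.slitPlane) (h1 : w ≠ 1) :
    phi ν ℓ w = lerchRat 0 ℓ w - w ^ ν * lerchRat ν ℓ w := by
  induction ℓ generalizing w with
  | zero =>
    have h := sub_one_mul_phi_zero ν w
    have h2 : 1 - w ≠ 0 := sub_ne_zero.mpr (Ne.symm h1)
    simp only [lerchRat]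
    field_simp
    linear_combination -h
  | succ ℓ ih =>
    have h0 := Complex.slitPlane_ne_zero hw
    have he : phi ν ℓ =ᶠ[𝓝 w] fun w => lerchRat 0 ℓ w - w ^ ν * lerchRat ν ℓ w := by
      filter_upwards [Complex.isOpen_slitPlane.mem_nhds hw, isOpen_ne.mem_nhds h1] with u hu hu1
      exact ih hu hu1
    have hd : ∀ ω, HasDerivAt (lerchRat ω ℓ) (deriv (lerchRat ω ℓ) w) w := fun ω =>
      (analyticOnNhd_lerchRat ω ℓ w h1).differentiableAt.hasDerivAt
    have h := (hd 0).sub (((hasDerivAt_id w).cpow_const (c := ν) hw).mul (hd ν))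
    have hdd : deriv (phi ν ℓ) w = _ := he.deriv_eq.trans h.deriv
    simp only [phi, lerchRat, hdd, id]
    rw [Complex.cpow_sub _ _ h0, Complex.cpow_one]
    field_simp
    ring

/-- Starting from a divided difference, `phi` is holomorphic through w = 1, so its value there is
the limit that fills the removable singularity. -/
theorem incLerchNeg_eq_phi (ν : ℂ) (ℓ : ℕ) {w : ℂ} (hw : w ∈ Complex.slitPlane) :
    incLerchNeg w ℓ 0 ν = phi ν ℓ w := by
  have key : ∀ u ∈ Complex.slitPlane, u ≠ 1 →
      lerchNeg u ℓ 0 - u ^ ν * lerchNeg u ℓ (0 + ν) = phi ν ℓ u := fun u hu hu1 => by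
    rw [lerchNeg_eq u hu1, lerchNeg_eq u hu1, zero_add, phi_eq_lerchRat ν ℓ hu hu1]
  unfold incLerchNeg
  split_ifs with h1
  · subst h1
    refine Tendsto.limUnder_eq ?_
    have hc := (differentiableAt_phi ν ℓ hw).continuousAt.tendsto.mono_left
      (nhdsWithin_le_nhds (s := {1}ᶜ))
    refine hc.congr' ?_
    filter_upwards [self_mem_nhdsWithin,
      nhdsWithin_le_nhds (Complex.isOpen_slitPlane.mem_nhds hw)] with u hu1 hu
    exact (key u hu hu1).symm
  · exact key w hw h1

/-! ### Operator calculus for polynomials in w d/dw -/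

open Polynomial

/-- The linear functional `Q ↦ Q(w d/dw) ((1 - w ^ ν) / (1 - w))`. -/
def lerchOp (ν w : ℂ) : ℂ[X] →ₗ[ℂ] ℂ := Polynomial.lsum fun ℓ => phi ν ℓ w • LinearMap.id

theorem lerchOp_monomial (ν w : ℂ) (ℓ : ℕ) (c : ℂ) :
    lerchOp ν w (monomial ℓ c) = c * phi ν ℓ w := by
  simp [lerchOp, mul_comm]

theorem lerchOp_C_mul (ν w c : ℂ) (Q : ℂ[X]) : lerchOp ν w (C c * Q) = c * lerchOp ν w Q := by
  rw [C_mul', map_smul, smul_eq_mul]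

theorem lerchOp_eq_sum_range (ν w : ℂ) (Q : ℂ[X]) {n : ℕ} (hn : Q.natDegree < n) :
    lerchOp ν w Q = ∑ ℓ ∈ Finset.range n, Q.coeff ℓ * phi ν ℓ w := by
  conv_lhs => rw [Q.as_sum_range' n hn]
  rw [map_sum]
  simp_rw [lerchOp_monomial]

/-- Under this calculus w d/dw is multiplication by `X`; this converts differential equations in w
into polynomial identities. -/
theorem hasDerivAt_lerchOp (ν : ℂ) (Q : ℂ[X]) {w : ℂ} (hw : w ∈ Complex.slitPlane) :
    HasDerivAt (fun w => lerchOp ν w Q) (lerchOp ν w (X * Q) / w) w := by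
  have h0 := Complex.slitPlane_ne_zero hw
  induction Q using Polynomial.induction_on' with
  | add p q hp hq =>
    simp only [mul_add, map_add, add_div]
    exact hp.add hq
  | monomial ℓ c =>
    simp only [X_mul_monomial, lerchOp_monomial, phi]
    convert! (differentiableAt_phi ν ℓ hw).hasDerivAt.const_mul c using 1
    field_simp

/-- For ν = n this is the index shift in ∑_{j<n} Q(j) w^j, with its two end terms. For general ν the
case Q = 1 is the definition of `phi ν 0`. Applying w d/dw to the identity for X^ℓ gives the one for
X^(ℓ+1); the factor w on the left supplies the summand 1 in X + 1. -/
theorem lerchOp_comp_X_add_one (ν : ℂ) (Q : ℂ[X]) {w : ℂ} (hw : w ∈ Complex.slitPlane) :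
    w * lerchOp ν w (Q.comp (X + 1)) = lerchOp ν w Q - Q.eval 0 + Q.eval ν * w ^ ν := by
  induction Q using Polynomial.induction_on' with
  | add p q hp hq =>
    simp only [add_comp, map_add, eval_add]
    linear_combination hp + hq
  | monomial ℓ c =>
    suffices h : w * lerchOp ν w ((X ^ ℓ : ℂ[X]).comp (X + 1))
        = lerchOp ν w (X ^ ℓ) - (X ^ ℓ : ℂ[X]).eval 0 + (X ^ ℓ : ℂ[X]).eval ν * w ^ ν by
      rw [← C_mul_X_pow_eq_monomial, mul_comp, C_comp, lerchOp_C_mul, lerchOp_C_mul, eval_mul,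
        eval_mul, eval_C, eval_C]
      linear_combination c * h
    induction ℓ generalizing w with
    | zero =>
      have h := sub_one_mul_phi_zero ν w
      have h1 : lerchOp ν w 1 = phi ν 0 w := by simpa using lerchOp_monomial ν w 0 1
      simp only [pow_zero, one_comp, h1, eval_one]
      linear_combination h
    | succ ℓ ih =>
      have h0 := Complex.slitPlane_ne_zero hw
      have hl : HasDerivAt (fun w => w * lerchOp ν w ((X ^ ℓ : ℂ[X]).comp (X + 1))) _ w :=
        (hasDerivAt_id w).mul (hasDerivAt_lerchOp ν _ hw)
      have hr : HasDerivAt (fun w => lerchOp ν w (X ^ ℓ) - (X ^ ℓ : ℂ[X]).eval 0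
          + (X ^ ℓ : ℂ[X]).eval ν * w ^ ν) _ w :=
        ((hasDerivAt_lerchOp ν (X ^ ℓ) hw).sub_const _).add
          (((hasDerivAt_id w).cpow_const (c := ν) hw).const_mul _)
      have he := hr.congr_of_eventuallyEq (f₁ := fun w =>
        w * lerchOp ν w ((X ^ ℓ : ℂ[X]).comp (X + 1)))
        (by filter_upwards [Complex.isOpen_slitPlane.mem_nhds hw] with u hu using ih hu)
      have h := hl.unique he
      simp only [id, Complex.cpow_sub _ _ h0, Complex.cpow_one] at h
      rw [pow_succ', mul_comp, X_comp, add_mul, one_mul, map_add]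
      simp only [eval_mul, eval_X]
      field_simp at h
      linear_combination h

theorem expansionTerm_eq (ν : ℂ) (α₁ α₂ : ℝ) {y₁ y₂ : ℝ} (h₁ : 0 < y₁) (h₂ : 0 < y₂) (k : ℕ) :
    expansionTerm ν α₁ α₂ y₁ y₂ k
      = 1 / (y₁ : ℂ) * lerchOp ν ((y₂ / y₁ : ℝ) : ℂ) (pPoly α₁ α₂ k) := by
  rw [expansionTerm, lerchOp_eq_sum_range ν _ _ (Nat.lt_succ_of_le (natDegree_pPoly α₁ α₂ k))]
  congr 1
  refine Finset.sum_congr rfl fun ℓ _ => ?_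
  rw [← Complex.ofReal_div, incLerchNeg_eq_phi, pCoeff_eq_coeff]
  exact Complex.ofReal_mem_slitPlane.mpr (div_pos h₂ h₁)

/-! ### Convergence for integer `ν` -/

/-- The quotient (1 - w^n)/(1 - w) is a finite geometric sum, and w d/dw multiplies w^j by j. -/
theorem lerchOp_natCast (n : ℕ) (Q : ℂ[X]) {w : ℂ} (hw : w ∈ Complex.slitPlane) :
    lerchOp n w Q = ∑ j ∈ Finset.range n, Q.eval (j : ℂ) * w ^ j := by
  suffices h : ∀ ℓ, phi n ℓ w = ∑ j ∈ Finset.range n, (j : ℂ) ^ ℓ * w ^ j by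
    induction Q using Polynomial.induction_on' with
    | add p q hp hq => simp only [map_add, hp, hq, eval_add, add_mul, Finset.sum_add_distrib]
    | monomial ℓ c =>
      simp only [lerchOp_monomial, h, Finset.mul_sum, eval_monomial, mul_assoc]
  intro ℓ
  induction ℓ generalizing w with
  | zero =>
    by_cases h1 : w = 1
    · subst h1
      simp [phi, dslope_same, Complex.cpow_natCast]
    · have h := sub_one_mul_phi_zero n w
      rw [Complex.cpow_natCast] at h
      simp only [pow_zero, one_mul]
      refine mul_left_cancel₀ (sub_ne_zero.mpr h1) ?_
      rw [h, mul_geom_sum]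
  | succ ℓ ih =>
    have he : phi n ℓ =ᶠ[𝓝 w] fun w => ∑ j ∈ Finset.range n, (j : ℂ) ^ ℓ * w ^ j := by
      filter_upwards [Complex.isOpen_slitPlane.mem_nhds hw] with u hu using ih hu
    change w * deriv (phi n ℓ) w = _
    rw [he.deriv_eq, deriv_fun_sum (by fun_prop), Finset.mul_sum]
    refine Finset.sum_congr rfl fun j _ => ?_
    rw [deriv_const_mul _ (by fun_prop), deriv_pow_field]
    rcases j with _ | j
    · simp
    · rw [Nat.add_sub_cancel]; ring

/-- At x = -j the Gamma ratio is the product of the factors 1 - i/α for 1 ≤ i ≤ j, a polynomial of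
degree j in 1/α. -/
theorem ratioCoeff_neg_natCast_eq_zero (j k : ℕ) (h : j < k) : ratioCoeff k (-(j : ℂ)) = 0 := by
  induction j generalizing k with
  | zero => simp [ratioCoeff_zero_right, h.ne']
  | succ j ih =>
    obtain ⟨k, rfl⟩ : ∃ i, k = i + 1 := ⟨k - 1, by omega⟩
    rw [ratioCoeff_succ, show -((j + 1 : ℕ) : ℂ) + 1 = -(j : ℂ) by push_cast; ring,
      ih _ (by omega), ih _ (by omega)]
    simp

/-- The generating series is the product of 1/(1 + iτ) over i < j. Each step of the induction
multiplies by one more absolutely convergent geometric series, the last having ratio of modulus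
(j-1)τ. -/
theorem summable_pow_mul_ratioCoeff (j : ℕ) {τ : ℝ} (hτ : 0 ≤ τ) (h : (j - 1 : ℝ) * τ < 1) :
    Summable fun k => ‖(τ : ℂ) ^ k * ratioCoeff k j‖ := by
  induction j with
  | zero =>
    refine summable_of_ne_finset_zero (s := {0}) fun k hk => ?_
    have : k ≠ 0 := by simpa using hk
    simp [ratioCoeff_zero_right, this]
  | succ j ih =>
    have hj : (j : ℝ) * τ < 1 := by simpa using h
    have hs : Summable fun k => ‖(-(j * τ : ℂ)) ^ k‖ := by
      simp only [norm_pow]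
      refine summable_geometric_of_lt_one (norm_nonneg _) ?_
      simpa [abs_of_nonneg hτ] using hj
    have hc := summable_norm_sum_mul_antidiagonal_of_summable_norm hs (ih (by nlinarith))
    refine hc.congr fun k => ?_
    congr 1
    have hser : ratioSeries τ (j + 1) = PowerSeries.mk (fun k => (-(j * τ : ℂ)) ^ k)
        * ratioSeries τ j := by
      rw [ratioSeries_eq τ j, ← mul_assoc]
      conv_lhs => rw [← one_mul (ratioSeries _ _)]
      congr 1
      ext k
      rw [mul_add, mul_one, map_add, mul_left_comm, PowerSeries.coeff_C_mul]
      rcases k with _ | k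
      · simp
      · rw [PowerSeries.coeff_succ_mul_X]
        simp [PowerSeries.coeff_one, pow_succ]
        ring
    have hco := congrArg (PowerSeries.coeff k) hser
    rw [PowerSeries.coeff_mul] at hco
    simp only [ratioSeries, PowerSeries.coeff_mk] at hco
    rw [Nat.cast_add_one]
    exact hco.symm

theorem summable_eval_pPoly (j : ℕ) {α₁ α₂ : ℝ} (h₂ : 0 < α₂) (h : (j : ℝ) - 1 < α₂) :
    Summable fun k => ‖(pPoly α₁ α₂ k).eval (j : ℂ)‖ := by
  have h1 : Summable fun k => ‖(1 / α₁ : ℂ) ^ k * ratioCoeff k (-1 - j)‖ := by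
    refine summable_of_ne_finset_zero (s := Finset.range (j + 2)) fun k hk => ?_
    have : j + 1 < k := by simpa [Nat.succ_le_iff] using hk
    rw [show (-1 - j : ℂ) = -((j + 1 : ℕ) : ℂ) by push_cast; ring,
      ratioCoeff_neg_natCast_eq_zero _ _ this]
    simp
  have h2 : Summable fun k => ‖(1 / α₂ : ℂ) ^ k * ratioCoeff k j‖ := by
    have := summable_pow_mul_ratioCoeff j (τ := 1 / α₂) (by positivity)
      (by rw [mul_one_div, div_lt_one h₂]; exact h)
    simpa using this
  refine (summable_norm_sum_mul_antidiagonal_of_summable_norm h1 h2).congr fun k => ?_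
  rw [eval_pPoly, PowerSeries.coeff_mul]
  simp only [ratioSeries, PowerSeries.coeff_mk]

theorem summable_expansionTerm (n : ℕ) (α₁ α₂ y₁ y₂ : ℝ) (h₂ : 0 < α₂) (hy₁ : 0 < y₁)
    (hy₂ : 0 < y₂) (h : (n : ℝ) - 2 < α₂) :
    Summable fun k : ℕ => ‖expansionTerm (n : ℂ) α₁ α₂ y₁ y₂ k‖ := by
  have hw : ((y₂ / y₁ : ℝ) : ℂ) ∈ Complex.slitPlane :=
    Complex.ofReal_mem_slitPlane.mpr (div_pos hy₂ hy₁)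
  simp_rw [expansionTerm_eq _ _ _ hy₁ hy₂, lerchOp_natCast n _ hw, norm_mul]
  refine Summable.mul_left _ ?_
  refine Summable.of_nonneg_of_le (fun _ => norm_nonneg _) (fun k => norm_sum_le _ _) ?_
  refine summable_sum fun j hj => ?_
  simp_rw [norm_mul]
  refine (summable_eval_pPoly j h₂ ?_).mul_right _
  -- The largest evaluation point is n - 1, which turns j - 1 < α₂ into n - 2 < α₂.
  have : (j : ℝ) + 1 ≤ n := by exact_mod_cast Finset.mem_range.mp hj
  linarith

end

section

/-! ### Functions of at most polynomial growth at `0` and `∞` -/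

/-- `f` is bounded on `(0, ∞)` by a multiple of a power of `v + 1 / v`. -/
def PolyBdd (f : ℝ → ℂ) : Prop :=
  ∃ (C : ℝ) (A : ℕ), 0 ≤ C ∧ ∀ v, 0 < v → ‖f v‖ ≤ C * (v + v⁻¹) ^ A

theorem one_le_add_inv {v : ℝ} (hv : 0 < v) : 1 ≤ v + v⁻¹ := by
  rcases le_total 1 v with h | h
  · have := inv_pos.mpr hv; linarith
  · have := (one_le_inv₀ hv).mpr h; linarith

theorem PolyBdd.mono {f g : ℝ → ℂ} (hg : PolyBdd g) (h : ∀ v, 0 < v → ‖f v‖ ≤ ‖g v‖) :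
    PolyBdd f := by
  obtain ⟨C, A, hC, hA⟩ := hg
  exact ⟨C, A, hC, fun v hv => (h v hv).trans (hA v hv)⟩

theorem polyBdd_const (c : ℂ) : PolyBdd fun _ => c :=
  ⟨‖c‖, 0, norm_nonneg _, fun v _ => by simp⟩

theorem polyBdd_ofReal : PolyBdd fun v => (v : ℂ) :=
  ⟨1, 1, zero_le_one, fun v hv => by
    have := inv_pos.mpr hv
    rw [Complex.norm_real, Real.norm_of_nonneg hv.le]; linarith⟩

theorem PolyBdd.add {f g : ℝ → ℂ} (hf : PolyBdd f) (hg : PolyBdd g) :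
    PolyBdd fun v => f v + g v := by
  obtain ⟨C, A, hC, hA⟩ := hf
  obtain ⟨D, B, hD, hB⟩ := hg
  refine ⟨C + D, A + B, add_nonneg hC hD, fun v hv => ?_⟩
  have h1 := one_le_add_inv hv
  rw [add_mul]
  refine (norm_add_le _ _).trans (add_le_add ((hA v hv).trans ?_) ((hB v hv).trans ?_))
  · exact mul_le_mul_of_nonneg_left (pow_le_pow_right₀ h1 (by omega)) hC
  · exact mul_le_mul_of_nonneg_left (pow_le_pow_right₀ h1 (by omega)) hD

theorem PolyBdd.mul {f g : ℝ → ℂ} (hf : PolyBdd f) (hg : PolyBdd g) :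
    PolyBdd fun v => f v * g v := by
  obtain ⟨C, A, hC, hA⟩ := hf
  obtain ⟨D, B, hD, hB⟩ := hg
  refine ⟨C * D, A + B, mul_nonneg hC hD, fun v hv => ?_⟩
  rw [norm_mul, pow_add, mul_mul_mul_comm]
  exact mul_le_mul (hA v hv) (hB v hv) (norm_nonneg _) ((norm_nonneg _).trans (hA v hv))

theorem polyBdd_sum {ι : Type*} (s : Finset ι) {f : ι → ℝ → ℂ} (hf : ∀ i ∈ s, PolyBdd (f i)) :
    PolyBdd fun v => ∑ i ∈ s, f i v := by
  classical
  induction s using Finset.induction_on with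
  | empty => simpa using polyBdd_const 0
  | insert i s hi ih =>
    simp only [Finset.sum_insert hi]
    exact (hf i (by simp)).add (ih fun j hj => hf j (by simp [hj]))

theorem polyBdd_cpow (ν : ℂ) : PolyBdd fun v => (v : ℂ) ^ ν := by
  refine ⟨1, ⌈|ν.re|⌉₊, zero_le_one, fun v hv => ?_⟩
  rw [Complex.norm_cpow_eq_rpow_re_of_pos hv, one_mul]
  have h1 := one_le_add_inv hv
  have hi := inv_pos.mpr hv
  have h2 : v ^ ν.re ≤ (v + v⁻¹) ^ |ν.re| := by
    rcases le_total 0 ν.re with h | h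
    · rw [abs_of_nonneg h]
      exact Real.rpow_le_rpow hv.le (by linarith) h
    · rw [abs_of_nonpos h, ← neg_neg ν.re, Real.rpow_neg hv.le, ← Real.inv_rpow hv.le, neg_neg]
      exact Real.rpow_le_rpow hi.le (by linarith) (by linarith)
  refine h2.trans ?_
  rw [← Real.rpow_natCast]
  exact Real.rpow_le_rpow_of_exponent_le h1 (Nat.le_ceil _)

/-- Outside [1/2, 3/2], dividing by 1 - v costs at most a factor 2; inside, continuity on a compact
set suffices. -/
theorem polyBdd_of_sub_one_mul {f : ℝ → ℂ} (hc : ContinuousOn f (Set.Ioi 0))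
    (h : PolyBdd fun v => (1 - (v : ℂ)) * f v) : PolyBdd f := by
  obtain ⟨C, A, hC, hA⟩ := h
  obtain ⟨D, hD⟩ := (isCompact_Icc (a := (1 / 2 : ℝ)) (b := 3 / 2)).exists_bound_of_continuousOn
    (hc.mono fun _ hv => lt_of_lt_of_le (by norm_num) hv.1)
  refine ⟨2 * C + |D|, A, by positivity, fun v hv => ?_⟩
  have h1 : 1 ≤ (v + v⁻¹) ^ A := one_le_pow₀ (one_le_add_inv hv)
  by_cases hv' : v ∈ Set.Icc (1 / 2 : ℝ) (3 / 2)
  · have := (hD v hv').trans (le_abs_self D)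
    nlinarith [abs_nonneg D, mul_nonneg hC (zero_le_one.trans h1),
      mul_le_mul_of_nonneg_left h1 (abs_nonneg D)]
  · have h2 : 1 / 2 ≤ ‖1 - (v : ℂ)‖ := by
      rw [← Complex.ofReal_one, ← Complex.ofReal_sub, Complex.norm_real, Real.norm_eq_abs, le_abs]
      by_contra hcon
      push Not at hcon
      exact hv' ⟨by linarith, by linarith⟩
    have h3 := hA v hv
    rw [norm_mul] at h3
    have h4 := mul_le_mul_of_nonneg_right h2 (norm_nonneg (f v))
    nlinarith [mul_nonneg (abs_nonneg D) (zero_le_one.trans h1)]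

open Polynomial

theorem continuousOn_phi_ofReal (ν : ℂ) (ℓ : ℕ) :
    ContinuousOn (fun v : ℝ => phi ν ℓ v) (Set.Ioi 0) := fun _ hv =>
  ((differentiableAt_phi ν ℓ (Complex.ofReal_mem_slitPlane.mpr hv)).continuousAt.comp
    Complex.continuous_ofReal.continuousAt).continuousWithinAt

/-- The shift identity for X^ℓ, with (X+1)^ℓ expanded, expresses (1 - v) φ_ℓ through v^ν, constants
and the φ_j with j < ℓ. -/
theorem polyBdd_phi (ν : ℂ) (ℓ : ℕ) : PolyBdd fun v => phi ν ℓ v := by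
  induction ℓ using Nat.strong_induction_on with
  | _ ℓ ih =>
    refine polyBdd_of_sub_one_mul (continuousOn_phi_ofReal ν ℓ) ?_
    have hb : PolyBdd fun v => (0 : ℂ) ^ ℓ + -ν ^ ℓ * (v : ℂ) ^ ν
        + v * ∑ j ∈ Finset.range ℓ, (ℓ.choose j : ℂ) * phi ν j v := by
      refine ((polyBdd_const _).add ((polyBdd_const _).mul (polyBdd_cpow ν))).add
        (polyBdd_ofReal.mul (polyBdd_sum _ fun j hj => ?_))
      exact (polyBdd_const _).mul (ih j (Finset.mem_range.mp hj))
    refine hb.mono fun v hv => le_of_eq (congrArg _ ?_)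
    have h := lerchOp_comp_X_add_one ν (X ^ ℓ) (Complex.ofReal_mem_slitPlane.mpr hv)
    have hX : ∀ j, lerchOp ν v (X ^ j) = phi ν j v := fun j => by
      rw [X_pow_eq_monomial, lerchOp_monomial, one_mul]
    rw [X_pow_comp, add_pow, Finset.sum_range_succ, map_add, map_sum] at h
    simp only [one_pow, mul_one, Nat.choose_self, Nat.cast_one, hX, eval_pow, eval_X] at h
    have h2 : ∀ j, lerchOp ν v (X ^ j * (ℓ.choose j : ℂ[X])) = (ℓ.choose j : ℂ) * phi ν j v :=
      fun j => by rw [mul_comm, ← C_eq_natCast, lerchOp_C_mul, hX]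
    simp only [h2] at h
    linear_combination -h

theorem polyBdd_lerchOp (ν : ℂ) (Q : ℂ[X]) : PolyBdd fun v => lerchOp ν v Q := by
  simp_rw [fun v : ℝ => lerchOp_eq_sum_range ν (v : ℂ) Q (Nat.lt_succ_self _)]
  exact polyBdd_sum _ fun j _ => (polyBdd_const _).mul (polyBdd_phi ν j)

/-! ### Uniform bounds in the shape parameters -/

theorem norm_weight_le {α₁ α₂ : ℝ} (h₁ : 0 < α₁) (h₂ : 0 < α₂) {m k : ℕ} (hm : m ≤ k) :
    ‖1 / ((α₁ : ℂ) ^ m * (α₂ : ℂ) ^ (k - m))‖ ≤ (1 / α₁ + 1 / α₂) ^ k := by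
  have e1 : 0 < 1 / α₁ := by positivity
  have e2 : 0 < 1 / α₂ := by positivity
  rw [norm_div, norm_mul, norm_pow, norm_pow, Complex.norm_real, Complex.norm_real, norm_one,
    Real.norm_of_nonneg h₁.le, Real.norm_of_nonneg h₂.le]
  calc 1 / (α₁ ^ m * α₂ ^ (k - m))
      = (1 / α₁) ^ m * (1 / α₂) ^ (k - m) := by
        rw [one_div_pow, one_div_pow, one_div_mul_one_div]
    _ ≤ (1 / α₁ + 1 / α₂) ^ m * (1 / α₁ + 1 / α₂) ^ (k - m) := by
        gcongr <;> linarith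
    _ = _ := by rw [← pow_add, Nat.add_sub_cancel' hm]

/-- The shape parameters enter `pPoly` only through scalar weights of total degree k, so finitely
many fixed polynomials need bounding. A general `T` lets one lemma serve the expansion terms and
both parts of `defectPoly`. -/
theorem exists_lerchOp_pPoly_bound (ν : ℂ) (k : ℕ) (T : ℂ[X] →ₗ[ℂ] ℂ[X]) :
    ∃ (C : ℝ) (A : ℕ), 0 ≤ C ∧ ∀ α₁ α₂ v : ℝ, 0 < α₁ → 0 < α₂ → 0 < v →
      ‖lerchOp ν v (T (pPoly α₁ α₂ k))‖ ≤ C * (1 / α₁ + 1 / α₂) ^ k * (v + v⁻¹) ^ A := by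
  have hb : PolyBdd fun v => ∑ m ∈ Finset.range (k + 1),
      ((‖lerchOp ν v (T (pairPoly m (k - m)))‖ : ℝ) : ℂ) :=
    polyBdd_sum _ fun m _ => (polyBdd_lerchOp ν (T (pairPoly m (k - m)))).mono fun v _ => by simp
  obtain ⟨C, A, hC, hA⟩ := hb
  refine ⟨C, A, hC, fun α₁ α₂ v h₁ h₂ hv => ?_⟩
  have h := hA v hv
  beta_reduce at h
  rw [← Complex.ofReal_sum, Complex.norm_real,
    Real.norm_of_nonneg (Finset.sum_nonneg fun _ _ => norm_nonneg _)] at h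
  rw [pPoly, map_sum, map_sum, mul_right_comm, mul_comm _ (_ ^ k)]
  refine le_trans ?_ (mul_le_mul_of_nonneg_left h (by positivity))
  rw [Finset.mul_sum]
  refine (norm_sum_le _ _).trans (Finset.sum_le_sum fun m hm => ?_)
  rw [C_mul', map_smul, map_smul, norm_smul]
  exact mul_le_mul_of_nonneg_right
    (norm_weight_le h₁ h₂ (by simpa [Nat.lt_succ_iff] using hm)) (norm_nonneg _)

theorem exists_lerchOp_defectPoly_bound (ν : ℂ) (k : ℕ) :
    ∃ (C : ℝ) (A : ℕ), 0 ≤ C ∧ ∀ α₁ α₂ v : ℝ, 0 < α₁ → 0 < α₂ → 0 < v →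
      ‖lerchOp ν v (defectPoly α₁ α₂ k)‖ ≤ C * (1 / α₁ + 1 / α₂) ^ (k + 1) * (v + v⁻¹) ^ A := by
  obtain ⟨C₂, A₂, hC₂, hA₂⟩ := exists_lerchOp_pPoly_bound ν k
    (LinearMap.mulLeft ℂ X ∘ₗ (aeval (X + 1 : ℂ[X])).toLinearMap)
  obtain ⟨C₁, A₁, hC₁, hA₁⟩ := exists_lerchOp_pPoly_bound ν k (LinearMap.mulLeft ℂ (X + 2))
  refine ⟨C₂ + C₁, A₂ + A₁, add_nonneg hC₂ hC₁, fun α₁ α₂ v h₁ h₂ hv => ?_⟩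
  have e1 : 0 < 1 / α₁ := by positivity
  have e2 : 0 < 1 / α₂ := by positivity
  have hM := one_le_add_inv hv
  have b : ∀ α : ℝ, 0 < α → 1 / α ≤ 1 / α₁ + 1 / α₂ → ∀ (Q : ℂ[X]) (C : ℝ) (A : ℕ), 0 ≤ C →
      A ≤ A₂ + A₁ → ‖lerchOp ν v Q‖ ≤ C * (1 / α₁ + 1 / α₂) ^ k * (v + v⁻¹) ^ A →
      ‖lerchOp ν v (Polynomial.C (1 / (α : ℂ)) * Q)‖
        ≤ C * (1 / α₁ + 1 / α₂) ^ (k + 1) * (v + v⁻¹) ^ (A₂ + A₁) := by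
    intro α hα hle Q C A hC hA hQ
    rw [lerchOp_C_mul, norm_mul, norm_div, norm_one, Complex.norm_real, Real.norm_of_nonneg hα.le]
    calc 1 / α * ‖lerchOp ν v Q‖
        ≤ (1 / α₁ + 1 / α₂) * (C * (1 / α₁ + 1 / α₂) ^ k * (v + v⁻¹) ^ A) :=
          mul_le_mul hle hQ (norm_nonneg _) (by positivity)
      _ = C * (1 / α₁ + 1 / α₂) ^ (k + 1) * (v + v⁻¹) ^ A := by ring
      _ ≤ _ := mul_le_mul_of_nonneg_left (pow_le_pow_right₀ hM hA) (by positivity)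
  rw [defectPoly, map_add, add_mul C₂, add_mul (C₂ * _)]
  refine (norm_add_le _ _).trans (add_le_add ?_ ?_)
  · exact b α₂ h₂ (by linarith) _ C₂ A₂ hC₂ (by omega) (hA₂ α₁ α₂ v h₁ h₂ hv)
  · exact b α₁ h₁ (by linarith) _ C₁ A₁ hC₁ (by omega) (hA₁ α₁ α₂ v h₁ h₂ hv)

end

section

/-! ### Asymptotic expansion of ratios of Gamma functions -/

open MeasureTheory

/-- The normalized ratio `Γ(α) α ^ x / Γ(α + x)`. -/
def gammaRatio (α : ℝ) (x : ℂ) : ℂ := Complex.Gamma α / Complex.Gamma (α + x) * (α : ℂ) ^ x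

theorem image_exp_neg_Ioi : (fun t : ℝ => Real.exp (-t)) '' Set.Ioi 0 = Set.Ioo 0 1 := by
  ext y
  constructor
  · rintro ⟨t, ht, rfl⟩
    exact ⟨Real.exp_pos _, Real.exp_lt_one_iff.mpr (by simpa using ht)⟩
  · rintro ⟨h0, h1⟩
    exact ⟨-Real.log y, by simpa using Real.log_neg h0 h1, by simp [Real.exp_log h0]⟩

theorem ofReal_exp_cpow (t : ℝ) (s : ℂ) : ((Real.exp t : ℝ) : ℂ) ^ s = Complex.exp (t * s) := by
  rw [Complex.cpow_def_of_ne_zero (by exact_mod_cast (Real.exp_pos t).ne'),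
    ← Complex.ofReal_log (Real.exp_pos t).le, Real.log_exp]

/-- The substitution e^(-t) produces the Laplace integral to which Watson's lemma applies. -/
theorem betaIntegral_eq_laplace (α : ℝ) (x : ℂ) : Complex.betaIntegral α x
    = ∫ t : ℝ in Set.Ioi 0, Complex.exp (-(α * t)) * (1 - Complex.exp (-t)) ^ (x - 1) := by
  have hd : ∀ t ∈ Set.Ioi (0 : ℝ),
      HasDerivWithinAt (fun t : ℝ => Real.exp (-t)) (-Real.exp (-t)) (Set.Ioi 0) t := fun t _ => by
    simpa using ((hasDerivAt_neg t).exp).hasDerivWithinAt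
  have hinj : Set.InjOn (fun t : ℝ => Real.exp (-t)) (Set.Ioi 0) := fun s _ t _ h => by
    simpa using h
  rw [Complex.betaIntegral, intervalIntegral.integral_of_le zero_le_one,
    integral_Ioc_eq_integral_Ioo, ← image_exp_neg_Ioi,
    integral_image_eq_integral_abs_deriv_smul measurableSet_Ioi hd hinj]
  refine setIntegral_congr_fun measurableSet_Ioi fun t _ => ?_
  rw [abs_neg, abs_of_pos (Real.exp_pos _), Complex.real_smul, ofReal_exp_cpow, ← mul_assoc,
    Complex.ofReal_exp, ← Complex.exp_add]
  push_cast
  ring_nf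

/-- The values `(1 - e ^ (-t)) / t` lie in `(0, 1]`. -/
theorem one_sub_exp_neg_div_mem {t : ℝ} (ht : 0 < t) :
    0 < (1 - Real.exp (-t)) / t ∧ (1 - Real.exp (-t)) / t ≤ 1 := by
  constructor
  · have : Real.exp (-t) < 1 := Real.exp_lt_one_iff.mpr (by linarith)
    exact div_pos (by linarith) ht
  · rw [div_le_one ht]
    have := Real.add_one_le_exp (-t)
    linarith

theorem nPow_neg_eq (x : ℂ) {t : ℝ} (ht : 0 < t) :
    nPow (1 - x) (-t) = (((1 - Real.exp (-t)) / t : ℝ) : ℂ) ^ (x - 1) := by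
  have h := one_sub_exp_neg_div_mem ht
  have hb : nBase (-t) = (((1 - Real.exp (-t)) / t : ℝ) : ℂ)⁻¹ := by
    rw [nBase, if_neg (by simpa using ht.ne')]
    push_cast
    rw [inv_div, ← neg_sub, neg_div_neg_eq]
  rw [nPow, hb, Complex.inv_cpow, ← Complex.cpow_neg, neg_sub]
  rw [Complex.arg_ofReal_of_nonneg h.1.le]
  exact Real.pi_pos.ne

theorem one_sub_exp_neg_cpow (x : ℂ) {t : ℝ} (ht : 0 < t) :
    (1 - Complex.exp (-t)) ^ (x - 1) = (t : ℂ) ^ (x - 1) * nPow (1 - x) (-t) := by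
  rw [nPow_neg_eq x ht, ← Complex.mul_cpow_ofReal_nonneg ht.le (one_sub_exp_neg_div_mem ht).1.le,
    ← Complex.ofReal_mul, mul_div_cancel₀ _ ht.ne']
  push_cast
  rfl

/-- Taylor's theorem only covers t < δ. For t ≥ δ the function has modulus at most 1, by Re x ≥ 1,
and each t^k with k ≤ K is at most t^(K+1)/δ^(K+1-k); `S` collects these constants. -/
theorem exists_nPow_taylor_bound {x : ℂ} (hx : 1 ≤ x.re) (K : ℕ) :
    ∃ C : ℝ, 0 ≤ C ∧ ∀ t : ℝ, 0 < t →
      ‖nPow (1 - x) (-t) - ∑ k ∈ Finset.range (K + 1),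
        norlund k (1 - x) / k.factorial * (-(t : ℂ)) ^ k‖ ≤ C * t ^ (K + 1) := by
  have hT := (analyticAt_nPow (1 - x)).hasFPowerSeriesAt.isBigO_sub_partialSum_pow (K + 1)
  obtain ⟨C₀, hC₀, hT⟩ := hT.exists_pos
  rw [IsBigOWith, Metric.eventually_nhds_iff] at hT
  obtain ⟨δ, hδ, hT⟩ := hT
  set S : ℝ := 1 / δ ^ (K + 1) + ∑ k ∈ Finset.range (K + 1),
    ‖norlund k (1 - x) / k.factorial‖ * (1 / δ ^ (K + 1 - k)) with hS
  have hS0 : 0 ≤ S := by positivity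
  refine ⟨C₀ + S, by positivity, fun t ht => ?_⟩
  have htK : 0 < t ^ (K + 1) := by positivity
  rw [add_mul]
  by_cases htδ : t < δ
  · have h := hT (y := -(t : ℂ)) (by simpa [abs_of_pos ht] using htδ)
    rw [zero_add, norm_pow, norm_norm, norm_neg, Complex.norm_real, Real.norm_of_nonneg ht.le,
      FormalMultilinearSeries.partialSum] at h
    refine le_trans (le_of_eq ?_) (h.trans (le_add_of_nonneg_right (by positivity)))
    congr 2
    refine Finset.sum_congr rfl fun k _ => ?_
    rw [FormalMultilinearSeries.ofScalars_apply_eq, smul_eq_mul, norlund_eq]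
  · push Not at htδ
    refine le_trans ?_ (le_add_of_nonneg_left (by positivity : 0 ≤ C₀ * t ^ (K + 1)))
    rw [hS, add_mul, Finset.sum_mul]
    refine (norm_sub_le _ _).trans (add_le_add ?_ ((norm_sum_le _ _).trans
      (Finset.sum_le_sum fun k hk => ?_)))
    · have h := one_sub_exp_neg_div_mem ht
      rw [nPow_neg_eq x ht, Complex.norm_cpow_eq_rpow_re_of_pos h.1, one_div_mul_eq_div]
      refine (Real.rpow_le_one h.1.le h.2 (by simpa using hx)).trans ?_
      rw [one_le_div (by positivity)]
      gcongr
    · have hk' := Finset.mem_range.mp hk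
      rw [norm_mul, norm_pow, norm_neg, Complex.norm_real, Real.norm_of_nonneg ht.le, mul_assoc]
      refine mul_le_mul_of_nonneg_left ?_ (norm_nonneg _)
      rw [one_div_mul_eq_div, le_div_iff₀ (by positivity)]
      calc t ^ k * δ ^ (K + 1 - k) ≤ t ^ k * t ^ (K + 1 - k) := by gcongr
        _ = t ^ (K + 1) := by rw [← pow_add, Nat.add_sub_cancel' hk'.le]

theorem Gamma_add_natCast_mul {x : ℂ} (hx : 0 < x.re) (k : ℕ) :
    (-1) ^ k * Complex.Gamma (x + k)
      = Complex.Gamma x * (k.factorial * Ring.choose (-x) k) := by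
  induction k with
  | zero => simp
  | succ k ih =>
    have h1 := mul_ring_choose_sub_one k (-x)
    have h2 := succ_mul_ring_choose_succ k (-x)
    have h0 : x + k ≠ 0 := fun h => by
      have := congrArg Complex.re h
      simp at this
      have hk : (0 : ℝ) ≤ k := k.cast_nonneg
      linarith
    rw [Nat.cast_add_one, ← add_assoc, Complex.Gamma_add_one _ h0, Nat.factorial_succ]
    push_cast
    linear_combination (-(x + k)) * ih - Complex.Gamma x * k.factorial * (h1 + h2)

theorem integrableOn_cpow_mul_exp {a : ℂ} {r : ℝ} (ha : 0 < a.re) (hr : 0 < r) :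
    IntegrableOn (fun t : ℝ => (t : ℂ) ^ (a - 1) * Complex.exp (-(r * t))) (Set.Ioi 0) := by
  have h := integrableOn_rpow_mul_exp_neg_mul_rpow (s := a.re - 1) (p := 1) (b := r)
    (by linarith) one_pos hr
  refine Integrable.mono' h ?_ ?_
  · refine ContinuousOn.aestronglyMeasurable (fun t ht => ?_) measurableSet_Ioi
    refine ContinuousAt.continuousWithinAt ?_
    exact (Complex.continuousAt_ofReal_cpow_const _ _ (Or.inr (ne_of_gt ht))).mul (by fun_prop)
  · filter_upwards [ae_restrict_mem measurableSet_Ioi] with t ht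
    rw [norm_mul, Complex.norm_cpow_eq_rpow_re_of_pos ht, Complex.norm_exp]
    simp

/-- Watson's lemma for B(α, x): the Taylor polynomial of the kernel integrates termwise to Gamma
values, the global remainder bound to one more power of 1/α, and everything is divided by Γ(x)
α^(-x). -/
theorem gammaRatio_isBigO_of_one_le {x : ℂ} (hx : 1 ≤ x.re) (K : ℕ) :
    (fun α : ℝ => gammaRatio α x
      - ∑ k ∈ Finset.range (K + 1), ratioCoeff k x * (1 / (α : ℂ)) ^ k)
      =O[atTop] fun α : ℝ => (1 / α) ^ (K + 1) := by
  have hx0 : 0 < x.re := by linarith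
  obtain ⟨C, hC, hT⟩ := exists_nPow_taylor_bound hx K
  have hG : Complex.Gamma x ≠ 0 := Complex.Gamma_ne_zero_of_re_pos hx0
  refine IsBigO.of_bound (C * Real.Gamma (x.re + (K + 1)) / ‖Complex.Gamma x‖) ?_
  filter_upwards [eventually_gt_atTop 0] with α hα
  have hαc : (α : ℂ) ≠ 0 := by exact_mod_cast hα.ne'
  set f : ℕ → ℝ → ℂ := fun k t =>
    (norlund k (1 - x) / k.factorial * (-1) ^ k) *
      ((t : ℂ) ^ (x + k - 1) * Complex.exp (-(α * t))) with hf
  have hfi : ∀ k, IntegrableOn (f k) (Set.Ioi 0) := fun k =>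
    (integrableOn_cpow_mul_exp (by simp; positivity) hα).const_mul _
  have hbeta : IntegrableOn (fun t : ℝ => Complex.exp (-(α * t)) * (1 - Complex.exp (-t)) ^ (x - 1))
      (Set.Ioi 0) := by
    have h := integrableOn_cpow_mul_exp (a := 1) (by simp) hα
    refine Integrable.mono' h.norm ?_ ?_
    · refine ContinuousOn.aestronglyMeasurable (fun t ht => ?_) measurableSet_Ioi
      refine ContinuousAt.continuousWithinAt (ContinuousAt.mul (by fun_prop) ?_)
      refine ContinuousAt.cpow (by fun_prop) (by fun_prop) ?_
      have : Real.exp (-t) < 1 := Real.exp_lt_one_iff.mpr (by simpa using ht)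
      rw [← Complex.ofReal_neg, ← Complex.ofReal_exp, ← Complex.ofReal_one, ← Complex.ofReal_sub]
      exact Complex.ofReal_mem_slitPlane.mpr (by linarith)
    · filter_upwards [ae_restrict_mem measurableSet_Ioi] with t ht
      have h1 : Real.exp (-t) < 1 := Real.exp_lt_one_iff.mpr (by simpa using ht)
      have h2 := Real.exp_pos (-t)
      rw [norm_mul, norm_mul, sub_self, Complex.cpow_zero, norm_one, one_mul]
      refine mul_le_of_le_one_right (norm_nonneg _) ?_
      rw [← Complex.ofReal_neg, ← Complex.ofReal_exp, ← Complex.ofReal_one, ← Complex.ofReal_sub,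
        Complex.norm_cpow_eq_rpow_re_of_pos (by linarith)]
      exact Real.rpow_le_one (by linarith) (by linarith) (by simpa using hx)
  have hint : ‖Complex.betaIntegral α x - ∑ k ∈ Finset.range (K + 1), ∫ t in Set.Ioi 0, f k t‖
      ≤ C * ((1 / α) ^ (x.re + (K + 1)) * Real.Gamma (x.re + (K + 1))) := by
    rw [betaIntegral_eq_laplace, ← integral_finsetSum _ fun k _ => hfi k,
      ← integral_sub hbeta (integrable_finsetSum _ fun k _ => hfi k),
      ← Real.integral_rpow_mul_exp_neg_mul_Ioi (by positivity) hα, ← integral_const_mul]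
    refine norm_integral_le_of_norm_le ?_ ?_
    · have h := integrableOn_rpow_mul_exp_neg_mul_rpow (s := x.re + (K + 1) - 1) (p := 1) (b := α)
        (by have : (0 : ℝ) ≤ K := K.cast_nonneg
            linarith) one_pos hα
      refine Integrable.const_mul ?_ C
      simpa [IntegrableOn] using h
    · filter_upwards [ae_restrict_mem measurableSet_Ioi] with t ht
      have ht0 : 0 < t := ht
      have ht' : (t : ℂ) ≠ 0 := by exact_mod_cast (ne_of_gt ht)
      have e : Complex.exp (-(α * t)) * (1 - Complex.exp (-t)) ^ (x - 1)
          - ∑ k ∈ Finset.range (K + 1), f k t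
          = (t : ℂ) ^ (x - 1) * Complex.exp (-(α * t)) * (nPow (1 - x) (-t)
            - ∑ k ∈ Finset.range (K + 1), norlund k (1 - x) / k.factorial * (-(t : ℂ)) ^ k) := by
        rw [one_sub_exp_neg_cpow x ht, mul_sub, Finset.mul_sum]
        congr 1
        · ring
        · refine Finset.sum_congr rfl fun k _ => ?_
          simp only [hf]
          rw [show x + k - 1 = (x - 1) + k by ring, Complex.cpow_add _ _ ht',
            Complex.cpow_natCast, neg_pow (t : ℂ)]
          ring
      rw [e, norm_mul, norm_mul, Complex.norm_cpow_eq_rpow_re_of_pos ht, Complex.norm_exp]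
      refine (mul_le_mul_of_nonneg_left (hT t ht) (by positivity)).trans (le_of_eq ?_)
      have hr : t ^ (x.re + (K + 1) - 1) = t ^ (x.re - 1) * t ^ (K + 1) := by
        rw [← Real.rpow_natCast t (K + 1), ← Real.rpow_add ht]
        congr 1
        push_cast
        ring
      rw [hr]
      simp
      ring
  have hfk : ∀ k, ∫ t in Set.Ioi 0, f k t
      = Complex.Gamma x * (1 / (α : ℂ)) ^ x * (ratioCoeff k x * (1 / (α : ℂ)) ^ k) := by
    intro k
    have hk : (k.factorial : ℂ) ≠ 0 := by exact_mod_cast k.factorial_ne_zero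
    rw [hf, integral_const_mul, Complex.integral_cpow_mul_exp_neg_mul_Ioi (by simp; positivity) hα,
      Complex.cpow_add _ _ (one_div_ne_zero hαc), Complex.cpow_natCast, ratioCoeff]
    have h := Gamma_add_natCast_mul hx0 k
    field_simp
    linear_combination norlund k (1 - x) * (1 / (α : ℂ)) ^ x * h
  have hB : Complex.betaIntegral α x
      = Complex.Gamma x * (1 / (α : ℂ)) ^ x * gammaRatio α x := by
    have h := Complex.Gamma_mul_Gamma_eq_betaIntegral (s := α) (t := x) (by simpa using hα) hx0
    have h1 : Complex.Gamma (α + x) ≠ 0 :=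
      Complex.Gamma_ne_zero_of_re_pos (by simp; positivity)
    have h2 : (1 / (α : ℂ)) ^ x * (α : ℂ) ^ x = 1 := by
      rw [one_div, Complex.inv_cpow, inv_mul_cancel₀ (by simp [Complex.cpow_eq_zero_iff, hαc])]
      rw [Complex.arg_ofReal_of_nonneg hα.le]
      exact Real.pi_pos.ne
    rw [gammaRatio]
    field_simp
    linear_combination -h - Complex.Gamma x * Complex.Gamma α * h2
  simp_rw [hfk] at hint
  rw [hB, ← Finset.mul_sum, ← mul_sub, norm_mul, norm_mul, one_div, ← Complex.ofReal_inv,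
    Complex.norm_cpow_eq_rpow_re_of_pos (by positivity), ← one_div,
    Real.rpow_add (by positivity)] at hint
  have hp : 0 < (1 / α) ^ x.re := by positivity
  have hGn : 0 < ‖Complex.Gamma x‖ := norm_pos_iff.mpr hG
  rw [Real.norm_of_nonneg (by positivity), div_mul_eq_mul_div, le_div_iff₀ hGn]
  rw [← Nat.cast_add_one, Real.rpow_natCast] at hint
  refine le_of_mul_le_mul_left ?_ hp
  simp only [Complex.ofReal_div, Complex.ofReal_one] at hint
  push_cast at hint ⊢
  linarith

/-- The functional equation carries the expansion from x + 1 to x, so finitely many steps remove the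
restriction Re x ≥ 1. -/
theorem gammaRatio_isBigO (x : ℂ) (K : ℕ) :
    (fun α : ℝ => gammaRatio α x
      - ∑ k ∈ Finset.range (K + 1), ratioCoeff k x * (1 / (α : ℂ)) ^ k)
      =O[atTop] fun α : ℝ => (1 / α) ^ (K + 1) := by
  obtain ⟨n, hn⟩ := exists_nat_ge (1 - x.re)
  induction n generalizing x with
  | zero => exact gammaRatio_isBigO_of_one_le (by simpa using hn) K
  | succ n ih =>
    have h := ih (x + 1) (by simp at hn ⊢; linarith)
    -- Here `α` stands for the reciprocal shape parameter; truncation leaves one term of order K +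
    -- 1.
    have hs : ∀ (α : ℂ) (K : ℕ), (1 + x * α)
          * ∑ k ∈ Finset.range (K + 1), ratioCoeff k (x + 1) * α ^ k
        = (∑ k ∈ Finset.range (K + 1), ratioCoeff k x * α ^ k)
          + x * ratioCoeff K (x + 1) * α ^ (K + 1) := by
      intro α K
      induction K with
      | zero => simp [ratioCoeff_zero_left]
      | succ K ihK =>
        rw [Finset.sum_range_succ, mul_add, ihK, Finset.sum_range_succ _ (K + 1), ratioCoeff_succ K x]
        ring
    have hb : (fun α : ℝ => 1 + x * (1 / (α : ℂ))) =O[atTop] fun _ => (1 : ℝ) := by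
      have : Tendsto (fun α : ℝ => 1 + x * (1 / (α : ℂ))) atTop (𝓝 (1 + x * ((0 : ℝ) : ℂ))) := by
        refine Tendsto.const_add _ (Tendsto.const_mul _ ?_)
        have := (Complex.continuous_ofReal.tendsto 0).comp tendsto_inv_atTop_zero
        refine this.congr fun α => ?_
        simp
      exact this.isBigO_one ℝ
    have hlast : (fun α : ℝ => x * ratioCoeff K (x + 1) * (1 / (α : ℂ)) ^ (K + 1))
        =O[atTop] fun α : ℝ => (1 / α) ^ (K + 1) := by
      refine IsBigO.const_mul_left (IsBigO.of_bound 1 (Eventually.of_forall fun α => ?_)) _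
      simp
    have h2 := (hb.mul h).add (g := fun α : ℝ => (1 : ℝ) * (1 / α) ^ (K + 1))
      (by simpa using hlast)
    simp only [one_mul] at h2
    refine h2.congr' ?_ EventuallyEq.rfl
    filter_upwards [eventually_gt_atTop 0, eventually_gt_atTop (-x.re)] with α hα hαx
    have hαc : (α : ℂ) ≠ 0 := by exact_mod_cast hα.ne'
    have h0 : (α + x : ℂ) ≠ 0 := fun h => by
      have := congrArg Complex.re h
      simp at this
      linarith
    have hr : gammaRatio α x = (1 + x * (1 / (α : ℂ))) * gammaRatio α (x + 1) := by
      rw [gammaRatio, gammaRatio, ← add_assoc, Complex.Gamma_add_one _ h0,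
        Complex.cpow_add _ _ hαc, Complex.cpow_one]
      field_simp
    rw [hr]
    linear_combination -hs (1 / (α : ℂ)) K

end

section

/-! ### Euler's integral for `F(1, b; c; u)` -/

open MeasureTheory

/-- The domain of the hypergeometric function. -/
def cutPlane : Set ℂ := {u : ℂ | 1 - u ∈ Complex.slitPlane}

theorem isOpen_cutPlane : IsOpen cutPlane :=
  Complex.isOpen_slitPlane.preimage (continuous_const.sub continuous_id)

theorem one_sub_mul_mem_slitPlane {u : ℂ} (hu : u ∈ cutPlane) {t : ℝ} (ht : t ∈ Set.Icc (0 : ℝ) 1) :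
    1 - u * t ∈ Complex.slitPlane := by
  have h := Complex.starConvex_one_slitPlane hu (a := 1 - t) (b := t) (by linarith [ht.2]) ht.1
    (by ring)
  convert! h using 1
  simp only [Complex.real_smul]
  push_cast
  ring

theorem starConvex_cutPlane : StarConvex ℝ 0 cutPlane := by
  intro u hu a b ha hb hab
  have h := one_sub_mul_mem_slitPlane hu (t := b) ⟨hb, by linarith⟩
  simp only [cutPlane, Set.mem_ofPred_eq, smul_zero, zero_add, Complex.real_smul]
  rwa [mul_comm]

theorem isPreconnected_cutPlane : IsPreconnected cutPlane :=
  (starConvex_cutPlane.isPathConnected (by simp [cutPlane])).isConnected.isPreconnected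

theorem continuous_ofReal_cpow {s : ℂ} (hs : 0 < s.re) : Continuous fun r : ℝ => (r : ℂ) ^ s :=
  continuous_iff_continuousAt.mpr fun _ => Complex.continuousAt_ofReal_cpow_const _ _ (Or.inl hs)

/-- The kernel of Euler's integral. -/
def eulerKernel (b c u : ℂ) (t : ℝ) : ℂ := ((1 - t : ℝ) : ℂ) ^ (c - 2) * (1 - u * t) ^ (-b)

/-- The derivative of the kernel of Euler's integral with respect to `u`. -/
def eulerKernelDeriv (b c u : ℂ) (t : ℝ) : ℂ :=
  ((1 - t : ℝ) : ℂ) ^ (c - 2) * (b * t * (1 - u * t) ^ (-b - 1))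

/-- Euler's integral. -/
def eulerIntegral (b c u : ℂ) : ℂ := ∫ t in (0 : ℝ)..1, eulerKernel b c u t

/-- The restriction 2 < Re c, harmless since c will be large, keeps Euler's integrand continuous on
the closed interval, so no improper integral occurs. -/
theorem continuous_weight {c : ℂ} (hc : 2 < c.re) :
    Continuous fun t : ℝ => ((1 - t : ℝ) : ℂ) ^ (c - 2) :=
  (continuous_ofReal_cpow (by simpa using hc)).comp (continuous_const.sub continuous_id)

theorem continuousOn_eulerKernel {b c u : ℂ} (hc : 2 < c.re) (hu : u ∈ cutPlane) :
    ContinuousOn (eulerKernel b c u) (Set.Icc 0 1) := by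
  refine (continuous_weight hc).continuousOn.mul fun t ht => ?_
  refine ContinuousAt.continuousWithinAt ?_
  exact ContinuousAt.cpow (by fun_prop) (by fun_prop) (one_sub_mul_mem_slitPlane hu ht)

theorem continuousOn_eulerKernelDeriv {b c : ℂ} (hc : 2 < c.re) :
    ContinuousOn (fun p : ℂ × ℝ => eulerKernelDeriv b c p.1 p.2) (cutPlane ×ˢ Set.Icc 0 1) := by
  intro p hp
  refine ContinuousAt.continuousWithinAt (ContinuousAt.mul ?_ (ContinuousAt.mul (by fun_prop) ?_))
  · exact (continuous_weight hc).continuousAt.comp continuous_snd.continuousAt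
  · exact ContinuousAt.cpow (by fun_prop) (by fun_prop) (one_sub_mul_mem_slitPlane hp.1 hp.2)

theorem hasDerivAt_eulerKernel (b c : ℂ) {u : ℂ} {t : ℝ} (ht : t ∈ Set.Icc (0 : ℝ) 1)
    (hu : u ∈ cutPlane) :
    HasDerivAt (fun u => eulerKernel b c u t) (eulerKernelDeriv b c u t) u := by
  have h1 : HasDerivAt (fun u : ℂ => 1 - u * t) (-(t : ℂ)) u := by
    simpa using ((hasDerivAt_id u).mul_const (t : ℂ)).const_sub 1
  convert! (h1.cpow_const (c := -b) (one_sub_mul_mem_slitPlane hu ht)).const_mul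
    (((1 - t : ℝ) : ℂ) ^ (c - 2)) using 1
  simp only [eulerKernelDeriv]
  ring

theorem hasDerivAt_eulerIntegral {b c u : ℂ} (hc : 2 < c.re) (hu : u ∈ cutPlane) :
    IntervalIntegrable (eulerKernelDeriv b c u) volume 0 1 ∧
      HasDerivAt (eulerIntegral b c) (∫ t in (0 : ℝ)..1, eulerKernelDeriv b c u t) u := by
  obtain ⟨r, hr, hball⟩ := Metric.nhds_basis_closedBall.mem_iff.mp (isOpen_cutPlane.mem_nhds hu)
  obtain ⟨B, hB⟩ := ((isCompact_closedBall u r).prod isCompact_Icc).exists_bound_of_continuousOn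
    ((continuousOn_eulerKernelDeriv (b := b) hc).mono (Set.prod_mono hball subset_rfl))
  have hI : Set.uIoc (0 : ℝ) 1 ⊆ Set.Icc 0 1 := by
    rw [Set.uIoc_of_le zero_le_one]; exact Set.Ioc_subset_Icc_self
  have hk : ∀ v ∈ cutPlane, ContinuousOn (eulerKernelDeriv b c v) (Set.Icc 0 1) := fun v hv =>
    (continuousOn_eulerKernelDeriv hc).comp (g := fun p : ℂ × ℝ => eulerKernelDeriv b c p.1 p.2)
      (f := fun t : ℝ => (v, t)) (by fun_prop) fun t ht => ⟨hv, ht⟩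
  refine intervalIntegral.hasDerivAt_integral_of_dominated_loc_of_deriv_le
    (F := eulerKernel b c) (F' := eulerKernelDeriv b c) (bound := fun _ => B) (Metric.closedBall_mem_nhds u hr) ?_ ?_ ?_ ?_ ?_ ?_
  · filter_upwards [isOpen_cutPlane.mem_nhds hu] with v hv
    exact ((continuousOn_eulerKernel hc hv).mono hI).aestronglyMeasurable measurableSet_uIoc
  · exact (continuousOn_eulerKernel hc hu).intervalIntegrable_of_Icc zero_le_one
  · exact ((hk u hu).mono hI).aestronglyMeasurable measurableSet_uIoc
  · exact ae_of_all _ fun t ht v hv => hB (v, t) ⟨hv, hI ht⟩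
  · exact intervalIntegrable_const
  · exact ae_of_all _ fun t ht v hv => hasDerivAt_eulerKernel b c (hI ht) (hball hv)

/-- The combined integrand is the t-derivative of -(1-t)^(c-1) (1-ut)^(-b), which runs from -1 at t
= 0 to 0 at t = 1. -/
theorem eulerIntegral_ode {b c u : ℂ} (hc : 2 < c.re) (hu : u ∈ cutPlane) :
    u * (1 - u) * deriv (eulerIntegral b c) u + (c - 1 - b * u) * eulerIntegral b c u = 1 := by
  obtain ⟨hi, hd⟩ := hasDerivAt_eulerIntegral (b := b) hc hu
  have hi0 : IntervalIntegrable (eulerKernel b c u) volume 0 1 :=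
    (continuousOn_eulerKernel hc hu).intervalIntegrable_of_Icc zero_le_one
  rw [hd.deriv, eulerIntegral, ← intervalIntegral.integral_const_mul,
    ← intervalIntegral.integral_const_mul,
    ← intervalIntegral.integral_add (hi.const_mul _) (hi0.const_mul _)]
  have hc1 : 0 < (c - 1).re := by simp; linarith
  have hft := intervalIntegral.integral_eq_sub_of_hasDerivAt_of_le (a := 0) (b := 1)
    (f := fun t : ℝ => -(((1 - t : ℝ) : ℂ) ^ (c - 1) * (1 - u * t) ^ (-b)))
    (f' := fun t => u * (1 - u) * eulerKernelDeriv b c u t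
      + (c - 1 - b * u) * eulerKernel b c u t) zero_le_one ?_ ?_
    ((hi.const_mul _).add (hi0.const_mul _))
  · rw [hft]
    have : c - 1 ≠ 0 := fun h => by simp [h] at hc1
    simp [this]
  · refine ContinuousOn.neg (ContinuousOn.mul ?_ fun t ht => ?_)
    · exact ((continuous_ofReal_cpow hc1).comp
        (continuous_const.sub continuous_id)).continuousOn
    · refine ContinuousAt.continuousWithinAt ?_
      exact ContinuousAt.cpow (by fun_prop) (by fun_prop) (one_sub_mul_mem_slitPlane hu ht)
  · intro t ht
    have ht1 : 0 < 1 - t := by linarith [ht.2]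
    have hs := one_sub_mul_mem_slitPlane hu ⟨ht.1.le, ht.2.le⟩
    have hs0 := Complex.slitPlane_ne_zero hs
    have ht0 : ((1 - t : ℝ) : ℂ) ≠ 0 := by exact_mod_cast ht1.ne'
    have h1 : HasDerivAt (fun z : ℂ => (1 - z) ^ (c - 1)) _ (t : ℂ) :=
      ((hasDerivAt_id (t : ℂ)).const_sub 1).cpow_const (c := c - 1)
        (by simpa using Complex.ofReal_mem_slitPlane.mpr ht1)
    have h2 : HasDerivAt (fun z : ℂ => (1 - u * z) ^ (-b)) _ (t : ℂ) :=
      (((hasDerivAt_id (t : ℂ)).const_mul u).const_sub 1).cpow_const (c := -b) hs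
    have h3 := ((h1.mul h2).neg).comp_ofReal
    convert! h3 using 1
    · ext s; simp
    · simp only [id, eulerKernel, eulerKernelDeriv]
      rw [show c - 1 - 1 = c - 2 by ring, show c - 1 = (c - 2) + 1 by ring,
        show (1 - t : ℂ) = ((1 - t : ℝ) : ℂ) by push_cast; rfl,
        Complex.cpow_add _ _ ht0, Complex.cpow_one, Complex.cpow_sub _ _ hs0, Complex.cpow_one]
      field_simp
      push_cast
      ring

theorem analyticOnNhd_eulerIntegral {b c : ℂ} (hc : 2 < c.re) :
    AnalyticOnNhd ℂ (eulerIntegral b c) cutPlane :=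
  DifferentiableOn.analyticOnNhd
    (fun _ hu => (hasDerivAt_eulerIntegral hc hu).2.differentiableAt.differentiableWithinAt)
    isOpen_cutPlane

theorem zero_mem_cutPlane : (0 : ℂ) ∈ cutPlane := by simp [cutPlane]

/-- The differential equation yields a two-term recurrence for the Taylor coefficients, so the
kernel need not be expanded under the integral. -/
theorem iteratedDeriv_eulerIntegral {b c : ℂ} (hc : 2 < c.re) (k : ℕ) :
    iteratedDeriv k (fun u => (c - 1) * eulerIntegral b c u) 0
      = k.factorial * ((ascPochhammer ℂ k).eval b / (ascPochhammer ℂ k).eval c) := by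
  have hf : AnalyticAt ℂ (eulerIntegral b c) 0 :=
    analyticOnNhd_eulerIntegral hc 0 zero_mem_cutPlane
  have hid : AnalyticAt ℂ (fun u : ℂ => u) 0 := analyticAt_id
  have hode : (fun u => u * deriv (eulerIntegral b c) u
      - u * (u * deriv (eulerIntegral b c) u)
      + ((c - 1) * eulerIntegral b c u - b * (u * eulerIntegral b c u))) =ᶠ[𝓝 0] fun _ => 1 := by
    filter_upwards [isOpen_cutPlane.mem_nhds zero_mem_cutPlane] with u hu
    linear_combination eulerIntegral_ode (b := b) hc hu
  have hrec : ∀ k : ℕ, (c - 1 + k) * iteratedDeriv k (eulerIntegral b c) 0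
      = k * (b + (k - 1)) * iteratedDeriv (k - 1) (eulerIntegral b c) 0
        + if k = 0 then 1 else 0 := by
    intro k
    have h := hode.iteratedDeriv_eq k
    have e1 : AnalyticAt ℂ (fun u => u * deriv (eulerIntegral b c) u) 0 := hid.mul hf.deriv
    have e2 : AnalyticAt ℂ (fun u => u * (u * deriv (eulerIntegral b c) u)) 0 := hid.mul e1
    have e3 : AnalyticAt ℂ (fun u => (c - 1) * eulerIntegral b c u) 0 := analyticAt_const.mul hf
    have e4 : AnalyticAt ℂ (fun u => b * (u * eulerIntegral b c u)) 0 :=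
      analyticAt_const.mul (hid.mul hf)
    have e12 : AnalyticAt ℂ (fun u => u * deriv (eulerIntegral b c) u
      - u * (u * deriv (eulerIntegral b c) u)) 0 := e1.sub e2
    have e34 : AnalyticAt ℂ (fun u => (c - 1) * eulerIntegral b c u
      - b * (u * eulerIntegral b c u)) 0 := e3.sub e4
    rw [iteratedDeriv_fun_add e12.contDiffAt e34.contDiffAt,
      iteratedDeriv_fun_sub e1.contDiffAt e2.contDiffAt,
      iteratedDeriv_fun_sub e3.contDiffAt e4.contDiffAt,
      iteratedDeriv_const_mul_field, iteratedDeriv_const_mul_field,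
      iteratedDeriv_id_mul_zero e1, iteratedDeriv_id_mul_zero hf, iteratedDeriv_const,
      iteratedDeriv_id_mul_zero hf.deriv, iteratedDeriv_id_mul_zero hf.deriv] at h
    rcases k with _ | _ | k
    · simp at h ⊢; linear_combination h
    · simp [← iteratedDeriv_succ'] at h ⊢
      linear_combination h
    · simp only [Nat.add_sub_cancel, ← iteratedDeriv_succ'] at h ⊢
      rw [if_neg (by omega)] at h ⊢
      push_cast at h ⊢
      linear_combination h
  have hne : ∀ k : ℕ, c + k ≠ 0 := fun k h => by
    have := congrArg Complex.re h
    simp at this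
    have hk : (0 : ℝ) ≤ k := k.cast_nonneg
    linarith
  have hP : ∀ k : ℕ, (ascPochhammer ℂ k).eval c ≠ 0 := by
    intro k
    induction k with
    | zero => simp
    | succ k ih => rw [ascPochhammer_succ_eval]; exact mul_ne_zero ih (hne k)
  rw [iteratedDeriv_const_mul_field]
  induction k with
  | zero => simpa using hrec 0
  | succ k ih =>
    have h := hrec (k + 1)
    rw [Nat.add_sub_cancel, if_neg k.succ_ne_zero, add_zero] at h
    have h0 := hne k
    have h1 := hP k
    rw [ascPochhammer_succ_eval, ascPochhammer_succ_eval, Nat.factorial_succ]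
    field_simp at ih ⊢
    push_cast at h ⊢
    linear_combination (c - 1) * (ascPochhammer ℂ k).eval c * h + (k + 1) * (b + k) * ih

theorem hyp2F1_eq_eulerIntegral {b c u : ℂ} (hc : 2 < c.re) (hu : u ∈ cutPlane) :
    hyp2F1 1 b c u = (c - 1) * eulerIntegral b c u := by
  have ha : AnalyticOnNhd ℂ (fun u => (c - 1) * eulerIntegral b c u) cutPlane := fun v hv =>
    analyticAt_const.mul (analyticOnNhd_eulerIntegral hc v hv)
  refine analyticCont_eq isPreconnected_cutPlane zero_mem_cutPlane ha ?_ hu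
  filter_upwards [eventually_hasSum_of_iteratedDeriv (ha 0 zero_mem_cutPlane)
    (iteratedDeriv_eulerIntegral (b := b) hc)] with v hv
  rw [ordinaryHypergeometric_eq_tsum, ← hv.tsum_eq]
  refine tsum_congr fun k => ?_
  have : (k.factorial : ℂ) ≠ 0 := by exact_mod_cast k.factorial_ne_zero
  rw [ascPochhammer_eval_one, smul_eq_mul]
  field_simp

theorem neg_ofReal_mem_cutPlane {z : ℝ} (hz : 0 ≤ z) : -(z : ℂ) ∈ cutPlane := by
  simp only [cutPlane, Set.mem_ofPred_eq, sub_neg_eq_add]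
  have : (1 + z : ℂ) = ((1 + z : ℝ) : ℂ) := by push_cast; rfl
  rw [this]
  exact Complex.ofReal_mem_slitPlane.mpr (by linarith)

theorem exists_hasDerivAt_hyp2F1_neg {b c : ℂ} (hc : 2 < c.re) {z : ℝ} (hz : 0 ≤ z) :
    ∃ d, HasDerivAt (fun z : ℝ => hyp2F1 1 b c (-z)) d z ∧
      z * (1 + z) * d + (c - 1 + b * z) * hyp2F1 1 b c (-z) = c - 1 := by
  have hu := neg_ofReal_mem_cutPlane hz
  have hd := (hasDerivAt_eulerIntegral (b := b) hc hu).2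
  have he : HasDerivAt (hyp2F1 1 b c) _ (-(z : ℂ)) := (hd.const_mul (c - 1)).congr_of_eventuallyEq
    (by filter_upwards [isOpen_cutPlane.mem_nhds hu] with v hv using
          hyp2F1_eq_eulerIntegral hc hv)
  have hn : HasDerivAt (fun w : ℂ => hyp2F1 1 b c (-w)) _ (z : ℂ) :=
    HasDerivAt.comp (z : ℂ) he (hasDerivAt_neg (z : ℂ))
  refine ⟨_, hn.comp_ofReal, ?_⟩
  have h := eulerIntegral_ode (b := b) hc hu
  rw [hd.deriv] at h
  rw [hyp2F1_eq_eulerIntegral hc hu]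
  linear_combination (c - 1) * h

/-- Factoring (1 + zt)^(-b) = z^(-b) (1/z + t)^(-b) leaves a parametric integral in y = 1/z,
continuous at y = 0 because Re b < 0, where it is a beta integral. -/
theorem tendsto_hyp2F1_neg_atTop {b c : ℂ} (hc : 2 < c.re) (hb : b.re < 0) :
    Tendsto (fun z : ℝ => (z : ℂ) ^ b * hyp2F1 1 b c (-z)) atTop
      (𝓝 (Complex.Gamma c * Complex.Gamma (1 - b) / Complex.Gamma (c - b))) := by
  set J : ℝ → ℂ := fun y => (c - 1) * ∫ t in (0 : ℝ)..1,
    ((1 - t : ℝ) : ℂ) ^ (c - 2) * ((y + t : ℝ) : ℂ) ^ (-b) with hJ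
  have hcont : Continuous J := by
    refine continuous_const.mul
      (intervalIntegral.continuous_parametric_intervalIntegral_of_continuous' ?_ 0 1)
    refine ((continuous_weight hc).comp continuous_snd).mul ?_
    exact (continuous_ofReal_cpow (s := -b) (by simpa using hb)).comp
      (continuous_fst.add continuous_snd)
  have hJ0 : J 0 = Complex.Gamma c * Complex.Gamma (1 - b) / Complex.Gamma (c - b) := by
    have hc1 : c - 1 ≠ 0 := fun h => by
      have := congrArg Complex.re h
      simp at this
      linarith
    have hbeta := Complex.Gamma_mul_Gamma_eq_betaIntegral (s := 1 - b) (t := c - 1)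
      (by simp; linarith) (by simp; linarith)
    have hG : Complex.Gamma (c - b) ≠ 0 := Complex.Gamma_ne_zero_of_re_pos (by simp; linarith)
    have hGc := Complex.Gamma_add_one (c - 1) hc1
    rw [sub_add_cancel] at hGc
    have hI : ∫ t in (0 : ℝ)..1, ((1 - t : ℝ) : ℂ) ^ (c - 2) * ((0 + t : ℝ) : ℂ) ^ (-b)
        = Complex.betaIntegral (1 - b) (c - 1) := by
      rw [Complex.betaIntegral]
      refine intervalIntegral.integral_congr fun t _ => ?_
      rw [zero_add, mul_comm, show 1 - b - 1 = -b by ring, show c - 1 - 1 = c - 2 by ring]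
      push_cast
      rfl
    rw [show 1 - b + (c - 1) = c - b by ring] at hbeta
    simp only [hJ]
    rw [hI, hGc, eq_div_iff hG]
    linear_combination -(c - 1) * hbeta
  have ht : Tendsto (fun z : ℝ => J z⁻¹) atTop (𝓝 (J 0)) :=
    (hcont.tendsto 0).comp tendsto_inv_atTop_zero
  rw [hJ0] at ht
  refine ht.congr' ?_
  filter_upwards [eventually_gt_atTop 0] with z hz
  rw [hyp2F1_eq_eulerIntegral hc (neg_ofReal_mem_cutPlane hz.le), eulerIntegral, mul_left_comm,
    ← intervalIntegral.integral_const_mul]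
  simp only [hJ]
  congr 1
  refine intervalIntegral.integral_congr fun t ht => ?_
  rw [Set.uIcc_of_le zero_le_one] at ht
  have hz0 : (z : ℂ) ^ (-b) ≠ 0 := by simp [Complex.cpow_eq_zero_iff, hz.ne']
  have h1 : (1 - -(z : ℂ) * t) = ((z * (z⁻¹ + t) : ℝ) : ℂ) := by
    rw [mul_add, mul_inv_cancel₀ hz.ne']; push_cast; ring
  have h2 : (z : ℂ) ^ b * (z : ℂ) ^ (-b) = 1 := by
    rw [Complex.cpow_neg, mul_inv_cancel₀]; simp [Complex.cpow_eq_zero_iff, hz.ne']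
  simp only [eulerKernel]
  rw [h1, Complex.ofReal_mul, Complex.mul_cpow_ofReal_nonneg hz.le
    (add_nonneg (inv_nonneg.mpr hz.le) ht.1)]
  linear_combination -(((1 - t : ℝ) : ℂ) ^ (c - 2) * ((z⁻¹ + t : ℝ) : ℂ) ^ (-b)) * h2

end

section

/-! ### A comparison principle for the differential equation in `Y₂ / Y₁` -/

/-- The integrating factor, multiplied by `v ^ p`. -/
def weight (a b p v : ℝ) : ℝ := v ^ (b - 1 + p) * (1 + b / a * v) ^ (3 - a - b)

section Weight

variable {a b : ℝ}

theorem weight_pos (ha : 0 < a) (hb : 0 < b) (p : ℝ) {v : ℝ} (hv : 0 < v) :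
    0 < weight a b p v := by
  unfold weight
  positivity

theorem weight_eq_rpow_mul (p : ℝ) {v : ℝ} (hv : 0 < v) :
    weight a b p v = v ^ p * weight a b 0 v := by
  rw [weight, weight, add_zero, Real.rpow_add hv]
  ring

theorem hasDerivAt_weight (ha : 0 < a) (hb : 0 < b) (p : ℝ) {v : ℝ} (hv : 0 < v) :
    HasDerivAt (weight a b p) (weight a b p v
      * ((b - 1 + p - b / a * v * (a - 2 - p)) / (v * (1 + b / a * v)))) v := by
  have h1 : 0 < 1 + b / a * v := by positivity
  have hd : HasDerivAt (weight a b p) _ v :=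
    ((hasDerivAt_id v).rpow_const (p := b - 1 + p) (Or.inl hv.ne')).mul
      ((((hasDerivAt_id v).const_mul (b / a)).const_add 1).rpow_const (p := 3 - a - b)
        (Or.inl h1.ne'))
  convert! hd using 1
  simp only [id, weight]
  rw [Real.rpow_sub_one hv.ne', Real.rpow_sub_one h1.ne']
  field_simp
  ring

theorem monotoneOn_weight (ha : 0 < a) (hb : 0 < b) (p c : ℝ)
    (h : ∀ v, 0 < v → v ≤ c → 0 ≤ b - 1 + p - b / a * v * (a - 2 - p)) :
    MonotoneOn (weight a b p) (Set.Ioc 0 c) := by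
  refine monotoneOn_of_deriv_nonneg (convex_Ioc 0 c)
    (fun v hv => (hasDerivAt_weight ha hb p hv.1).continuousAt.continuousWithinAt)
    (fun v hv => ?_) fun v hv => ?_
  all_goals rw [interior_Ioc] at hv
  · exact (hasDerivAt_weight ha hb p hv.1).differentiableAt.differentiableWithinAt
  · have hv1 : 0 < v := hv.1
    rw [(hasDerivAt_weight ha hb p hv.1).deriv]
    exact mul_nonneg (weight_pos ha hb p hv.1).le
      (div_nonneg (h v hv.1 hv.2.le) (by positivity))

theorem antitoneOn_weight (ha : 0 < a) (hb : 0 < b) (p : ℝ) {c : ℝ} (hc : 0 < c)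
    (h : ∀ v, c ≤ v → b - 1 + p - b / a * v * (a - 2 - p) ≤ 0) :
    AntitoneOn (weight a b p) (Set.Ici c) := by
  refine antitoneOn_of_deriv_nonpos (convex_Ici c)
    (fun v hv => (hasDerivAt_weight ha hb p (hc.trans_le hv)).continuousAt.continuousWithinAt)
    (fun v hv => ?_) fun v hv => ?_
  all_goals rw [interior_Ici] at hv
  · exact (hasDerivAt_weight ha hb p (hc.trans hv)).differentiableAt.differentiableWithinAt
  · have hv1 : 0 < v := hc.trans hv
    rw [(hasDerivAt_weight ha hb p hv1).deriv]
    exact mul_nonpos_of_nonneg_of_nonpos (weight_pos ha hb p hv1).le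
      (div_nonpos_of_nonpos_of_nonneg (h v (le_of_lt hv)) (by positivity))

/-- The constant must not depend on a, b. The weight peaks near 1 but not exactly there: v W(v)
increases on (0, 1], and v^(-N) W(v) increases on (0, 1/2] for large parameters. Small v is compared
first with 1/B ≤ 1/2, then 1/B with w. -/
theorem inv_pow_mul_weight_le {N : ℕ} (ha : 4 * (N + 2 : ℝ) ≤ a) (hb : 4 * (N + 2 : ℝ) ≤ b)
    {B v w : ℝ} (hB : 2 ≤ B) (hv : 0 < v) (hvw : v ≤ w) (hw : w ≤ 1) (hwB : w⁻¹ ≤ B) :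
    (v ^ N)⁻¹ * weight a b 0 v ≤ B ^ (N + 1) * weight a b 0 w := by
  have hN : (0 : ℝ) ≤ N := N.cast_nonneg
  have ha0 : 0 < a := by linarith
  have hb0 : 0 < b := by linarith
  have hB0 : 0 < B := by linarith
  have hw0 : 0 < w := hv.trans_le hvw
  have hBw : B⁻¹ ≤ w := inv_le_of_inv_le₀ hw0 hwB
  have hBi : 0 < B⁻¹ := inv_pos.mpr hB0
  have hB2 : B⁻¹ ≤ 1 / 2 := by rw [one_div]; exact inv_anti₀ two_pos hB
  have m1 : MonotoneOn (weight a b 1) (Set.Ioc 0 1) :=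
    monotoneOn_weight ha0 hb0 1 1 fun v hv hv1 => by
      have : b - 1 + 1 - b / a * v * (a - 2 - 1) = b * (1 - v) + b / a * v * 3 := by
        field_simp; ring
      rw [this]
      have : 0 ≤ b * (1 - v) := mul_nonneg hb0.le (by linarith)
      positivity
  have m2 : MonotoneOn (weight a b (-N)) (Set.Ioc 0 (1 / 2)) :=
    monotoneOn_weight ha0 hb0 _ _ fun v hv hv1 => by
      have h1 : b / a * v * (a - 2 - -N) ≤ b * (3 / 4) := by
        have : b / a * v * (a - 2 - -N) = b * (v * ((a - 2 + N) / a)) := by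
          field_simp; ring
        rw [this]
        have h2 : (a - 2 + N) / a ≤ 3 / 2 := by rw [div_le_iff₀ ha0]; linarith
        have h3 : v * ((a - 2 + N) / a) ≤ 1 / 2 * (3 / 2) :=
          mul_le_mul hv1 h2 (div_nonneg (by linarith) ha0.le) (by norm_num)
        exact mul_le_mul_of_nonneg_left (by linarith) hb0.le
      linarith
  have k1 : ∀ s, B⁻¹ ≤ s → s ≤ w → weight a b 0 s ≤ B * weight a b 0 w := by
    intro s hs hsw
    have hs0 : 0 < s := hBi.trans_le hs
    have h := m1 ⟨hs0, hsw.trans hw⟩ ⟨hw0, hw⟩ hsw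
    rw [weight_eq_rpow_mul 1 hs0, weight_eq_rpow_mul 1 hw0, Real.rpow_one, Real.rpow_one] at h
    have hW := weight_pos ha0 hb0 0 hs0
    have hW' := weight_pos ha0 hb0 0 hw0
    have h2 : B⁻¹ * weight a b 0 s ≤ weight a b 0 w := by nlinarith
    rwa [inv_mul_le_iff₀ hB0] at h2
  have hWw := weight_pos ha0 hb0 0 hw0
  rcases le_total v B⁻¹ with h | h
  · have h1 := m2 ⟨hv, h.trans hB2⟩ ⟨hBi, hB2⟩ h
    rw [weight_eq_rpow_mul _ hv, weight_eq_rpow_mul _ hBi, Real.rpow_neg hv.le,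
      Real.rpow_neg hBi.le, Real.rpow_natCast, Real.rpow_natCast, ← inv_pow B⁻¹, inv_inv] at h1
    refine h1.trans ?_
    rw [pow_succ, mul_assoc]
    exact mul_le_mul_of_nonneg_left (k1 _ le_rfl hBw) (by positivity)
  · rw [pow_succ, mul_assoc]
    refine mul_le_mul ?_ (k1 v h hvw) (weight_pos ha0 hb0 0 hv).le (by positivity)
    rw [← inv_pow]
    exact pow_le_pow_left₀ (by positivity) (inv_le_of_inv_le₀ hB0 h) _

/-- Mirror image to the right of the peak: v^(-2) W(v) decreases on [1, ∞) and v^N W(v) on [2, ∞),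
the intermediate point being B. -/
theorem pow_mul_weight_le {N : ℕ} (ha : 4 * (N + 2 : ℝ) ≤ a) (hb : 4 * (N + 2 : ℝ) ≤ b)
    {B v w : ℝ} (hB : 2 ≤ B) (hw : 1 ≤ w) (hvw : w ≤ v) (hwB : w ≤ B) :
    v ^ N * weight a b 0 v ≤ B ^ (N + 2) * weight a b 0 w := by
  have hN : (0 : ℝ) ≤ N := N.cast_nonneg
  have ha0 : 0 < a := by linarith
  have hb0 : 0 < b := by linarith
  have hB0 : 0 < B := by linarith
  have hw0 : 0 < w := by linarith
  have hv0 : 0 < v := by linarith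
  have m1 : AntitoneOn (weight a b (-2)) (Set.Ici 1) :=
    antitoneOn_weight ha0 hb0 _ one_pos fun v hv => by
      have : b - 1 + -2 - b / a * v * (a - 2 - -2) = b * (1 - v) - 3 := by
        field_simp; ring
      rw [this]
      have : 0 ≤ b * (v - 1) := mul_nonneg hb0.le (by linarith)
      linarith
  have m2 : AntitoneOn (weight a b N) (Set.Ici 2) :=
    antitoneOn_weight ha0 hb0 _ two_pos fun v hv => by
      have h1 : b * (3 / 2) ≤ b / a * v * (a - 2 - N) := by
        have : b / a * v * (a - 2 - N) = b * (v * ((a - 2 - N) / a)) := by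
          field_simp
        rw [this]
        have h2 : 3 / 4 ≤ (a - 2 - N) / a := by rw [le_div_iff₀ ha0]; linarith
        have h3 : 2 * (3 / 4) ≤ v * ((a - 2 - N) / a) :=
          mul_le_mul hv h2 (by norm_num) (by linarith)
        exact mul_le_mul_of_nonneg_left (by linarith) hb0.le
      linarith
  have k1 : ∀ s, w ≤ s → s ≤ B → weight a b 0 s ≤ B ^ 2 * weight a b 0 w := by
    intro s hs hsB
    have hs0 : 0 < s := by linarith
    have h := m1 hw (hw.trans hs) hs
    rw [weight_eq_rpow_mul _ hs0, weight_eq_rpow_mul _ hw0, Real.rpow_neg hs0.le,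
      Real.rpow_neg hw0.le, Real.rpow_two, Real.rpow_two, inv_mul_le_iff₀ (by positivity)] at h
    have hW' := weight_pos ha0 hb0 0 hw0
    refine h.trans (mul_le_mul (pow_le_pow_left₀ hs0.le hsB 2) ?_ (by positivity) (by positivity))
    exact mul_le_of_le_one_left hW'.le (inv_le_one_of_one_le₀ (one_le_pow₀ hw))
  rcases le_total B v with h | h
  · have h1 := m2 (Set.mem_Ici.mpr hB) (Set.mem_Ici.mpr (hB.trans h)) h
    rw [weight_eq_rpow_mul _ hv0, weight_eq_rpow_mul _ hB0, Real.rpow_natCast,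
      Real.rpow_natCast] at h1
    refine h1.trans ?_
    rw [pow_add, mul_assoc]
    exact mul_le_mul_of_nonneg_left (k1 _ hwB le_rfl) (by positivity)
  · rw [pow_add, mul_assoc]
    exact mul_le_mul (pow_le_pow_left₀ hv0.le h _) (k1 v hvw h) (weight_pos ha0 hb0 0 hv0).le
      (by positivity)

end Weight

theorem norm_le_of_deriv_le_of_tendsto_zero {u u' : ℝ → ℂ} {w D : ℝ} (hw : 0 < w)
    (hu : ∀ v, 0 < v → v ≤ w → HasDerivAt u (u' v) v) (hD : ∀ v, 0 < v → v ≤ w → ‖u' v‖ ≤ D)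
    (h0 : Tendsto u (𝓝[>] 0) (𝓝 0)) : ‖u w‖ ≤ D * w := by
  have h1 : ∀ᶠ s in 𝓝[>] (0 : ℝ), ‖u w - u s‖ ≤ D * w := by
    filter_upwards [Ioo_mem_nhdsGT hw] with s hs
    have h := (convex_Icc s w).norm_image_sub_le_of_norm_hasDerivWithin_le (f := u) (f' := u')
      (C := D) (fun v hv => (hu v (hs.1.trans_le hv.1) hv.2).hasDerivWithinAt)
      (fun v hv => hD v (hs.1.trans_le hv.1) hv.2) (Set.left_mem_Icc.mpr hs.2.le)
      (Set.right_mem_Icc.mpr hs.2.le)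
    refine h.trans ?_
    have hD0 : 0 ≤ D := (norm_nonneg _).trans (hD w hw le_rfl)
    rw [Real.norm_of_nonneg (by linarith [hs.2])]
    exact mul_le_mul_of_nonneg_left (by linarith [hs.1]) hD0
  have h2 : Tendsto (fun s => ‖u w - u s‖) (𝓝[>] 0) (𝓝 ‖u w - 0‖) :=
    (tendsto_const_nhds.sub h0).norm
  rw [sub_zero] at h2
  exact le_of_tendsto h2 h1

/-- The inversion y = 1/v reduces this to the endpoint 0; the factor v^(-2) in the hypothesis
cancels its Jacobian. -/
theorem norm_le_of_deriv_le_of_tendsto_atTop {u u' : ℝ → ℂ} {w D : ℝ} (hw : 0 < w)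
    (hu : ∀ v, w ≤ v → HasDerivAt u (u' v) v) (hD : ∀ v, w ≤ v → ‖u' v‖ ≤ D * (v ^ 2)⁻¹)
    (h0 : Tendsto u atTop (𝓝 0)) : ‖u w‖ ≤ D * w⁻¹ := by
  have h := norm_le_of_deriv_le_of_tendsto_zero (u := fun y => u y⁻¹)
    (u' := fun y => (-(y ^ 2)⁻¹) • u' y⁻¹) (w := w⁻¹) (D := D) (inv_pos.mpr hw)
    (fun v hv hvw => ?_) (fun v hv hvw => ?_) (h0.comp tendsto_inv_nhdsGT_zero)
  · simpa using h
  · exact (hu v⁻¹ (le_inv_of_le_inv₀ hv hvw)).scomp v (hasDerivAt_inv hv.ne')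
  · have h1 := hD v⁻¹ (le_inv_of_le_inv₀ hv hvw)
    rw [norm_smul, norm_neg, norm_inv, norm_pow, Real.norm_of_nonneg hv.le,
      inv_mul_le_iff₀ (by positivity)]
    rw [inv_pow, inv_inv] at h1
    linarith

/-- The differential operator annihilating the reciprocal of the integrating factor. -/
theorem hasDerivAt_weight_smul {a b v : ℝ} {Δ : ℝ → ℂ} {δ R : ℂ} (ha : 0 < a) (hb : 0 < b)
    (hv : 0 < v) (hd : HasDerivAt Δ δ v)
    (h : (1 / b + v / a) * v * δ + (1 - 1 / b - v * (1 - 2 / a)) * Δ v = R) :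
    HasDerivAt (fun v => weight a b 0 v • Δ v)
      ((weight a b 0 v / ((1 / b + v / a) * v)) • R) v := by
  have hW := hasDerivAt_weight ha hb 0 hv
  convert! hW.smul hd using 1
  rw [← h]
  simp only [Complex.real_smul]
  have hac : (a : ℂ) ≠ 0 := by exact_mod_cast ha.ne'
  have hbc : (b : ℂ) ≠ 0 := by exact_mod_cast hb.ne'
  have hvc : (v : ℂ) ≠ 0 := by exact_mod_cast hv.ne'
  have h1 : (1 / b + v / a : ℂ) ≠ 0 := by
    have : 0 < 1 / b + v / a := by positivity
    exact_mod_cast this.ne'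
  have h2 : (1 + b / a * v : ℂ) = b * (1 / b + v / a) := by field_simp
  push_cast
  rw [h2]
  generalize (1 / b + v / a : ℂ) = q at h1
  field_simp
  ring

/-- The function WΔ is integrated from 0 if w ≤ 1 and from ∞ if w ≥ 1, so the weight along the path
is controlled by its value at w. Dividing by the leading coefficient, which is only of size 1/a +
1/b, costs one order. -/
theorem norm_le_of_ode {a b E w B : ℝ} {A : ℕ} {Δ R : ℝ → ℂ} (ha : 4 * (A + 4 : ℝ) ≤ a)
    (hb : 4 * (A + 4 : ℝ) ≤ b) (hE : 0 ≤ E)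
    (hode : ∀ v : ℝ, 0 < v → ∃ δ, HasDerivAt Δ δ v ∧
      (1 / b + v / a) * v * δ + (1 - 1 / b - v * (1 - 2 / a)) * Δ v = R v)
    (hR : ∀ v, 0 < v → ‖R v‖ ≤ E * (v + v⁻¹) ^ A)
    (h0 : Tendsto (fun v => weight a b 0 v • Δ v) (𝓝[>] 0) (𝓝 0))
    (hT : Tendsto (fun v => weight a b 0 v • Δ v) atTop (𝓝 0))
    (hw : 0 < w) (hB : 2 ≤ B) (hwB : w ≤ B) (hwB' : w⁻¹ ≤ B) :
    ‖Δ w‖ ≤ 2 ^ A * B ^ (A + 3) * E / (1 / a + 1 / b) := by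
  have hA : (0 : ℝ) ≤ A := A.cast_nonneg
  have ha0 : 0 < a := by linarith
  have hb0 : 0 < b := by linarith
  have hB0 : 0 < B := by linarith
  have he : 0 < 1 / a + 1 / b := by positivity
  have hWw := weight_pos ha0 hb0 0 hw
  set u : ℝ → ℂ := fun v => weight a b 0 v • Δ v with hu
  set u' : ℝ → ℂ := fun v => (weight a b 0 v / ((1 / b + v / a) * v)) • R v with hu'
  have hder : ∀ v, 0 < v → HasDerivAt u (u' v) v := fun v hv => by
    obtain ⟨δ, hδ, h⟩ := hode v hv
    exact hasDerivAt_weight_smul ha0 hb0 hv hδ (by exact_mod_cast h)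
  have hnorm : ∀ v, 0 < v → ‖u' v‖ = weight a b 0 v / ((1 / b + v / a) * v) * ‖R v‖ :=
    fun v hv => by
      have := weight_pos ha0 hb0 0 hv
      rw [hu', norm_smul, Real.norm_of_nonneg (by positivity)]
  set D := 2 ^ A * E / (1 / a + 1 / b) * (B ^ (A + 3) * weight a b 0 w) with hD
  have hD0 : 0 ≤ D := by positivity
  suffices h : ‖u w‖ ≤ D by
    rw [hu, norm_smul, Real.norm_of_nonneg hWw.le] at h
    refine le_of_mul_le_mul_left (h.trans (le_of_eq ?_)) hWw
    rw [hD]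
    ring
  rcases le_total w 1 with hw1 | hw1
  · refine (norm_le_of_deriv_le_of_tendsto_zero hw (fun v hv _ => hder v hv)
      (fun v hv hvw => ?_) h0).trans (mul_le_of_le_one_right hD0 hw1)
    have hW := weight_pos ha0 hb0 0 hv
    have hv1 := hvw.trans hw1
    -- A powers of 1/v come from R and two from the lower bound v · (1/a + 1/b) · v for the leading
    -- coefficient; the hypothesis 4(A+4) ≤ a, b is 4(N+2) ≤ a, b for this N.
    have hk := inv_pow_mul_weight_le (a := a) (b := b) (N := A + 2) (by push_cast; linarith)
      (by push_cast; linarith) hB hv hvw hw1 hwB'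
    have hq : v * (1 / a + 1 / b) ≤ 1 / b + v / a := by
      have : v * (1 / b) ≤ 1 / b := mul_le_of_le_one_left (by positivity) hv1
      rw [mul_add, mul_one_div]
      linarith
    have hM : (v + v⁻¹) ^ A ≤ 2 ^ A * (v ^ A)⁻¹ := by
      rw [← inv_pow, ← mul_pow]
      refine pow_le_pow_left₀ (by positivity) ?_ A
      have := (one_le_inv₀ hv).mpr hv1
      linarith
    rw [hnorm v hv]
    calc weight a b 0 v / ((1 / b + v / a) * v) * ‖R v‖
        ≤ weight a b 0 v / (v * (1 / a + 1 / b) * v) * (E * (2 ^ A * (v ^ A)⁻¹)) := by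
          refine mul_le_mul ?_ ((hR v hv).trans (mul_le_mul_of_nonneg_left hM hE))
            (norm_nonneg _) (by positivity)
          gcongr
      _ = 2 ^ A * E / (1 / a + 1 / b) * ((v ^ (A + 2))⁻¹ * weight a b 0 v) := by
          field_simp
          ring
      _ ≤ D := mul_le_mul_of_nonneg_left hk (by positivity)
  · refine (norm_le_of_deriv_le_of_tendsto_atTop hw (fun v hv => hder v (hw.trans_le hv))
      (fun v hvw => ?_) hT).trans (mul_le_of_le_one_right hD0 (inv_le_one_of_one_le₀ hw1))
    have hv : 0 < v := hw.trans_le hvw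
    have hv1 : 1 ≤ v := hw1.trans hvw
    have hW := weight_pos ha0 hb0 0 hv
    -- A powers come from R, minus one from the leading coefficient, plus two to produce the
    -- required v^(-2).
    have hk := pow_mul_weight_le (a := a) (b := b) (N := A + 1) (by push_cast; linarith)
      (by push_cast; linarith) hB hw1 hvw hwB
    have hq : 1 / a + 1 / b ≤ 1 / b + v / a := by
      have : 1 / a ≤ v / a := by gcongr
      linarith
    have hM : (v + v⁻¹) ^ A ≤ 2 ^ A * v ^ A := by
      rw [← mul_pow]
      refine pow_le_pow_left₀ (by positivity) ?_ A
      have := inv_le_one_of_one_le₀ hv1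
      linarith
    rw [hnorm v hv]
    calc weight a b 0 v / ((1 / b + v / a) * v) * ‖R v‖
        ≤ weight a b 0 v / ((1 / a + 1 / b) * v) * (E * (2 ^ A * v ^ A)) := by
          refine mul_le_mul ?_ ((hR v hv).trans (mul_le_mul_of_nonneg_left hM hE))
            (norm_nonneg _) (by positivity)
          gcongr
      _ = 2 ^ A * E / (1 / a + 1 / b) * (v ^ (A + 1) * weight a b 0 v) * (v ^ 2)⁻¹ := by
          field_simp
          ring
      _ ≤ D * (v ^ 2)⁻¹ :=
          mul_le_mul_of_nonneg_right (mul_le_mul_of_nonneg_left hk (by positivity))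
            (by positivity)

end

section

/-! ### The asymptotic expansion of the weights -/

open Polynomial

theorem eventually_le_le (c : ℝ) :
    ∀ᶠ p : ℝ × ℝ in atTop ×ˢ atTop, c ≤ p.1 ∧ c ≤ p.2 :=
  (eventually_ge_atTop c).prod_mk (eventually_ge_atTop c)

theorem eventually_scale_le_one :
    ∀ᶠ p : ℝ × ℝ in atTop ×ˢ atTop, 0 < 1 / p.1 + 1 / p.2 ∧ 1 / p.1 + 1 / p.2 ≤ 1 := by
  filter_upwards [eventually_le_le 2] with p hp
  have h1 : 0 < p.1 := by linarith [hp.1]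
  have h2 : 0 < p.2 := by linarith [hp.2]
  have e1 : 1 / p.1 ≤ 1 / 2 := one_div_le_one_div_of_le two_pos hp.1
  have e2 : 1 / p.2 ≤ 1 / 2 := one_div_le_one_div_of_le two_pos hp.2
  exact ⟨by positivity, by linarith⟩

theorem isBigO_scale_pow_of_le {m n : ℕ} (h : n ≤ m) :
    (fun p : ℝ × ℝ => (1 / p.1 + 1 / p.2) ^ m) =O[atTop ×ˢ atTop]
      fun p => (1 / p.1 + 1 / p.2) ^ n := by
  refine IsBigO.of_bound 1 ?_
  filter_upwards [eventually_scale_le_one] with p hp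
  rw [one_mul, norm_pow, norm_pow, Real.norm_of_nonneg hp.1.le]
  exact pow_le_pow_of_le_one hp.1.le hp.2 h

theorem isBigO_inv_fst_pow (m : ℕ) :
    (fun p : ℝ × ℝ => (1 / p.1) ^ m) =O[atTop ×ˢ atTop] fun p => (1 / p.1 + 1 / p.2) ^ m := by
  refine IsBigO.pow (IsBigO.of_bound 1 ?_) m
  filter_upwards [eventually_le_le 2] with p hp
  have h1 : 0 < p.1 := by linarith [hp.1]
  have h2 : 0 < p.2 := by linarith [hp.2]
  have e2 : 0 < 1 / p.2 := by positivity
  rw [one_mul, Real.norm_of_nonneg (by positivity), Real.norm_of_nonneg (by positivity)]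
  linarith

theorem isBigO_inv_snd_pow (m : ℕ) :
    (fun p : ℝ × ℝ => (1 / p.2) ^ m) =O[atTop ×ˢ atTop] fun p => (1 / p.1 + 1 / p.2) ^ m := by
  refine IsBigO.pow (IsBigO.of_bound 1 ?_) m
  filter_upwards [eventually_le_le 2] with p hp
  have h1 : 0 < p.1 := by linarith [hp.1]
  have h2 : 0 < p.2 := by linarith [hp.2]
  have e2 : 0 < 1 / p.1 := by positivity
  rw [one_mul, Real.norm_of_nonneg (by positivity), Real.norm_of_nonneg (by positivity)]
  linarith

/-- The truncated expansion of a ratio of Gamma functions. -/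
def ratioSum (K : ℕ) (x : ℂ) (α : ℝ) : ℂ :=
  ∑ k ∈ Finset.range (K + 1), ratioCoeff k x * (1 / (α : ℂ)) ^ k

theorem ratioSum_isBigO_one (K : ℕ) (x : ℂ) :
    ratioSum K x =O[atTop] fun _ => (1 : ℝ) := by
  unfold ratioSum
  refine IsBigO.fun_sum fun k _ => IsBigO.const_mul_left (IsBigO.of_bound 1 ?_) _
  filter_upwards [eventually_ge_atTop 1] with α hα
  rw [one_mul, norm_one, norm_pow, norm_div, norm_one, Complex.norm_real,
    Real.norm_of_nonneg (by linarith)]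
  exact pow_le_one₀ (by positivity) (by rw [div_le_one (by linarith)]; exact hα)

theorem gammaRatio_isBigO_one (x : ℂ) :
    (fun α : ℝ => gammaRatio α x) =O[atTop] fun _ => (1 : ℝ) := by
  have h1 : (fun α : ℝ => (1 / α) ^ (0 + 1)) =O[atTop] fun _ => (1 : ℝ) := by
    have : Tendsto (fun α : ℝ => (1 / α) ^ (0 + 1)) atTop (𝓝 0) := by
      simpa using tendsto_inv_atTop_zero
    exact this.isBigO_one ℝ
  refine (((gammaRatio_isBigO x 0).trans h1).add (ratioSum_isBigO_one 0 x)).congr_left fun α => ?_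
  simp [ratioSum]

theorem eval_sum_pPoly (α₁ α₂ : ℝ) (K : ℕ) (x : ℂ) :
    (∑ k ∈ Finset.range (K + 1), pPoly α₁ α₂ k).eval x
      = ∑ m ∈ Finset.range (K + 1), ∑ j ∈ Finset.range (K + 1 - m),
        (ratioCoeff m (-1 - x) * (1 / (α₁ : ℂ)) ^ m) * (ratioCoeff j x * (1 / (α₂ : ℂ)) ^ j) := by
  rw [eval_finsetSum, ← Finset.sum_range_diag_flip (K + 1) fun m j =>
    (ratioCoeff m (-1 - x) * (1 / (α₁ : ℂ)) ^ m) * (ratioCoeff j x * (1 / (α₂ : ℂ)) ^ j)]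
  refine Finset.sum_congr rfl fun k _ => ?_
  rw [pPoly, eval_finsetSum]
  refine Finset.sum_congr rfl fun m _ => ?_
  rw [eval_mul, eval_C, eval_pairPoly, one_div_pow, one_div_pow, ← one_div_mul_one_div]
  ring

/-- The product of truncations runs over a square of indices, the partial sum over a triangle; all
remaining pairs have total order at least K + 1. -/
theorem ratioSum_mul_isBigO (K : ℕ) (x : ℂ) :
    (fun p : ℝ × ℝ => ratioSum K (-1 - x) p.1 * ratioSum K x p.2
      - (∑ k ∈ Finset.range (K + 1), pPoly p.1 p.2 k).eval x)
      =O[atTop ×ˢ atTop] fun p => (1 / p.1 + 1 / p.2) ^ (K + 1) := by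
  have h : ∀ p : ℝ × ℝ, ratioSum K (-1 - x) p.1 * ratioSum K x p.2
      - (∑ k ∈ Finset.range (K + 1), pPoly p.1 p.2 k).eval x
      = ∑ m ∈ Finset.range (K + 1), ∑ j ∈ Finset.range (K + 1) \ Finset.range (K + 1 - m),
        (ratioCoeff m (-1 - x) * (1 / (p.1 : ℂ)) ^ m)
          * (ratioCoeff j x * (1 / (p.2 : ℂ)) ^ j) := by
    intro p
    rw [eval_sum_pPoly, ratioSum, ratioSum, Finset.sum_mul_sum, ← Finset.sum_sub_distrib]
    refine Finset.sum_congr rfl fun m _ => ?_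
    rw [← Finset.sum_sdiff (Finset.range_mono (Nat.sub_le (K + 1) m))]
    ring
  simp_rw [h]
  refine IsBigO.fun_sum fun m _ => IsBigO.fun_sum fun j hj => ?_
  have hmj : K + 1 ≤ m + j := by
    rw [Finset.mem_sdiff, Finset.mem_range, Finset.mem_range] at hj
    omega
  refine IsBigO.trans ?_ (isBigO_scale_pow_of_le hmj)
  simp_rw [pow_add]
  refine IsBigO.mul (IsBigO.const_mul_left ?_ _) (IsBigO.const_mul_left ?_ _)
  · refine IsBigO.trans (IsBigO.of_bound 1 (Eventually.of_forall fun p => ?_)) (isBigO_inv_fst_pow m)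
    simp
  · refine IsBigO.trans (IsBigO.of_bound 1 (Eventually.of_forall fun p => ?_)) (isBigO_inv_snd_pow j)
    simp

theorem gammaRatio_mul_isBigO (K : ℕ) (x : ℂ) :
    (fun p : ℝ × ℝ => gammaRatio p.1 (-1 - x) * gammaRatio p.2 x
      - (∑ k ∈ Finset.range (K + 1), pPoly p.1 p.2 k).eval x)
      =O[atTop ×ˢ atTop] fun p => (1 / p.1 + 1 / p.2) ^ (K + 1) := by
  have h1 := ((gammaRatio_isBigO (-1 - x) K).comp_tendsto
    (tendsto_fst (f := atTop) (g := (atTop : Filter ℝ)))).trans (isBigO_inv_fst_pow (K + 1))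
  have h2 := ((gammaRatio_isBigO x K).comp_tendsto
    (tendsto_snd (f := (atTop : Filter ℝ)) (g := atTop))).trans (isBigO_inv_snd_pow (K + 1))
  have h3 := (gammaRatio_isBigO_one x).comp_tendsto
    (tendsto_snd (f := (atTop : Filter ℝ)) (g := atTop))
  have h4 := (ratioSum_isBigO_one K (-1 - x)).comp_tendsto
    (tendsto_fst (f := atTop) (g := (atTop : Filter ℝ)))
  have h5 := (h1.mul h3).add ((h4.mul h2).congr_right (g₂ := fun p : ℝ × ℝ =>
    (1 / p.1 + 1 / p.2) ^ (K + 1) * 1) fun p => by simp)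
  simp only [Function.comp_def, mul_one] at h5
  refine (h5.add (ratioSum_mul_isBigO K x)).congr_left fun p => ?_
  simp only [ratioSum]
  ring

/-! ### The differential equation of the estimator -/

/-- Differentiating z^ν contributes ν(1 + z), which undoes the shift of both parameters by ν. Both
summands thus obey the same homogeneous operator and differ only in their inhomogeneities. -/
theorem exists_hasDerivAt_incHyp {a b : ℝ} {ν : ℂ} (hb : 2 < b) (hbν : 2 < b + ν.re)
    {z : ℝ} (hz : 0 < z) :
    ∃ δ, HasDerivAt (fun z : ℝ => incHyp (2 - a) b z ν) δ z ∧
      z * (1 + z) * δ + (b - 1 + (2 - a) * z) * incHyp (2 - a) b z ν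
        = (b - 1) - (b + ν - 1) * ((z : ℂ) ^ ν / (cpoch (a - 1) (-ν) * cpoch b ν)) := by
  obtain ⟨d₁, hd₁, h₁⟩ := exists_hasDerivAt_hyp2F1_neg (b := 2 - a) (c := b) (by simpa using hb) hz.le
  obtain ⟨d₂, hd₂, h₂⟩ := exists_hasDerivAt_hyp2F1_neg (b := 2 - a + ν) (c := b + ν)
    (by simpa using hbν) hz.le
  have hzc : (z : ℂ) ≠ 0 := by exact_mod_cast hz.ne'
  have hp : HasDerivAt (fun z : ℝ => (z : ℂ) ^ ν) (ν * (z : ℂ) ^ (ν - 1)) z := by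
    simpa using ((hasDerivAt_id (z : ℂ)).cpow_const (c := ν)
      (Complex.ofReal_mem_slitPlane.mpr hz)).comp_ofReal
  have hd := hd₁.sub ((hp.div_const (cpoch (a - 1) (-ν) * cpoch b ν)).mul hd₂)
  refine ⟨_, HasDerivAt.congr_of_eventuallyEq hd (Eventually.of_forall fun z => ?_), ?_⟩
  · simp only [incHyp]
    rw [show (1 : ℂ) - (2 - a) = a - 1 by ring]
    rfl
  · simp only [incHyp]
    rw [show (1 : ℂ) - (2 - a) = a - 1 by ring, Complex.cpow_sub _ _ hzc, Complex.cpow_one]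
    have e : (z : ℂ) ^ ν / z * z = (z : ℂ) ^ ν := div_mul_cancel₀ _ hzc
    generalize (z : ℂ) ^ ν / z = q at *
    rw [← e]
    linear_combination h₁ - q * z / (cpoch (a - 1) (-ν) * cpoch b ν) * h₂

/-- The normalization (a-1)_{-ν} (b)_ν is exactly what makes the leading coefficients at ∞ cancel;
the homogeneous solution grows like z^(a-2), so this kills its contribution. -/
theorem tendsto_incHyp_atTop {a b : ℝ} {ν : ℂ} (hb : 2 < b) (hbν : 2 < b + ν.re) (ha : 2 < a)
    (haν : 2 < a - ν.re) :
    Tendsto (fun z : ℝ => (z : ℂ) ^ (2 - a : ℂ) * incHyp (2 - a) b z ν) atTop (𝓝 0) := by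
  have h1 := tendsto_hyp2F1_neg_atTop (b := 2 - a) (c := b) (by simpa using hb) (by simpa using ha)
  have h2 := tendsto_hyp2F1_neg_atTop (b := 2 - a + ν) (c := b + ν) (by simpa using hbν)
    (by simp; linarith)
  have h := h1.sub (h2.const_mul (1 / (cpoch (a - 1) (-ν) * cpoch b ν)))
  have hG : ∀ s : ℂ, 0 < s.re → Complex.Gamma s ≠ 0 := fun s => Complex.Gamma_ne_zero_of_re_pos
  have g1 := hG (a - 1) (by simp; linarith)
  have g2 := hG (a - 1 - ν) (by simp; linarith)
  have g3 := hG b (by simp; linarith)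
  have g4 := hG (b + ν) (by simp; linarith)
  have hz : Complex.Gamma b * Complex.Gamma (1 - (2 - a)) / Complex.Gamma (b - (2 - a))
      - 1 / (cpoch (a - 1) (-ν) * cpoch b ν) * (Complex.Gamma (b + ν)
        * Complex.Gamma (1 - (2 - a + ν)) / Complex.Gamma (b + ν - (2 - a + ν))) = 0 := by
    rw [show (1 : ℂ) - (2 - a) = a - 1 by ring, show (1 : ℂ) - (2 - a + ν) = a - 1 - ν by ring,
      show (b : ℂ) + ν - (2 - a + ν) = b - (2 - a) by ring, cpoch, cpoch, ← sub_eq_add_neg]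
    field_simp
    ring
  rw [hz] at h
  refine h.congr' ?_
  filter_upwards [eventually_gt_atTop 0] with z hz
  have hzc : (z : ℂ) ≠ 0 := by exact_mod_cast hz.ne'
  simp only [incHyp]
  rw [show (1 : ℂ) - (2 - a) = a - 1 by ring, Complex.cpow_add _ _ hzc]
  ring

theorem continuousAt_hyp2F1_neg_zero {b c : ℂ} (hc : 2 < c.re) :
    ContinuousAt (fun z : ℝ => hyp2F1 1 b c (-z)) 0 := by
  obtain ⟨d, hd, -⟩ := exists_hasDerivAt_hyp2F1_neg (b := b) hc le_rfl
  exact hd.continuousAt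

/-- The estimator as a function of `v = Y₂ / Y₁`, up to the factor `1 / Y₁`. -/
def estFun (ν : ℂ) (a b v : ℝ) : ℂ := (a - 1) / a * incHyp (2 - a) b ((b / a * v : ℝ) : ℂ) ν

theorem estimator_eq (ν : ℂ) (a b : ℝ) {y₁ y₂ : ℝ} :
    estimator ν a b y₁ y₂ = 1 / (y₁ : ℂ) * estFun ν a b (y₂ / y₁) := by
  rw [estimator, estFun]
  have : (b * y₂ / (a * y₁) : ℂ) = ((b / a * (y₂ / y₁) : ℝ) : ℂ) := by
    push_cast
    rw [div_mul_div_comm]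
  rw [this, ← div_div, div_eq_mul_one_div _ (y₁ : ℂ)]
  ring

theorem gammaRatio_neg_one_mul {a b : ℝ} (ha : 1 < a) (hb : 0 < b) :
    gammaRatio a (-1 - 0) * gammaRatio b 0 = (a - 1) / a := by
  have h1 : (a - 1 : ℂ) ≠ 0 := by
    have : a - 1 ≠ 0 := by linarith
    exact_mod_cast this
  have g1 : Complex.Gamma (a - 1) ≠ 0 := Complex.Gamma_ne_zero_of_re_pos (by simpa using ha)
  have g2 : Complex.Gamma b ≠ 0 := Complex.Gamma_ne_zero_of_re_pos (by simpa using hb)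
  have h2 := Complex.Gamma_add_one _ h1
  rw [sub_add_cancel] at h2
  rw [gammaRatio, gammaRatio, sub_zero, add_zero, Complex.cpow_zero, div_self g2, h2,
    Complex.cpow_neg_one, ← sub_eq_add_neg, mul_div_cancel_right₀ _ g1]
  ring

/-- The factor (b/a)^ν in z^ν matches the powers in the normalized Gamma ratios, so the
inhomogeneity becomes g(ν) v^ν, the quantity that the P_{2k} expand. -/
theorem gammaRatio_mul_eq {a b : ℝ} (ν : ℂ) (ha : 1 < a) (hb : 0 < b) {v : ℝ} (hv : 0 < v) :
    gammaRatio a (-1 - ν) * gammaRatio b ν * (v : ℂ) ^ ν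
      = (a - 1) / a * (((b / a * v : ℝ) : ℂ) ^ ν / (cpoch (a - 1) (-ν) * cpoch b ν)) := by
  have ha0 : 0 < a := by linarith
  have hac : (a : ℂ) ≠ 0 := by exact_mod_cast ha0.ne'
  have h1 : (a - 1 : ℂ) ≠ 0 := by
    have : a - 1 ≠ 0 := by linarith
    exact_mod_cast this
  have h2 := Complex.Gamma_add_one _ h1
  rw [sub_add_cancel] at h2
  have h3 : (((b / a * v : ℝ) : ℂ)) ^ ν = (b : ℂ) ^ ν * (a : ℂ) ^ (-ν) * (v : ℂ) ^ ν := by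
    rw [Complex.ofReal_mul, Complex.mul_cpow_ofReal_nonneg (by positivity) hv.le, div_eq_mul_inv,
      Complex.ofReal_mul, Complex.mul_cpow_ofReal_nonneg hb.le (by positivity),
      Complex.ofReal_inv, Complex.inv_cpow_ofReal_nonneg ha0.le, Complex.cpow_neg]
  rw [h3, gammaRatio, gammaRatio, cpoch, cpoch, h2, sub_eq_add_neg (-1 : ℂ),
    Complex.cpow_add _ _ hac, Complex.cpow_neg_one, show (a : ℂ) + (-1 + -ν) = a - 1 + -ν by ring]
  simp only [div_eq_mul_inv, mul_inv, inv_inv]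
  ring

theorem exists_hasDerivAt_estFun {a b : ℝ} {ν : ℂ} (ha : 1 < a) (hb : 2 < b)
    (hbν : 2 < b + ν.re) {v : ℝ} (hv : 0 < v) :
    ∃ δ, HasDerivAt (estFun ν a b) δ v ∧
      (1 / b + v / a) * v * δ + (1 - 1 / b - v * (1 - 2 / a)) * estFun ν a b v
        = (1 - 1 / b) * (gammaRatio a (-1 - 0) * gammaRatio b 0)
          - (1 + (ν - 1) / b) * (gammaRatio a (-1 - ν) * gammaRatio b ν * (v : ℂ) ^ ν) := by
  have ha0 : 0 < a := by linarith
  have hb0 : 0 < b := by linarith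
  have hac : (a : ℂ) ≠ 0 := by exact_mod_cast ha0.ne'
  have hbc : (b : ℂ) ≠ 0 := by exact_mod_cast hb0.ne'
  obtain ⟨δ, hδ, h⟩ := exists_hasDerivAt_incHyp (a := a) hb hbν (z := b / a * v) (by positivity)
  have hl : HasDerivAt (fun v : ℝ => b / a * v) (b / a) v := by
    simpa using (hasDerivAt_id v).const_mul (b / a)
  refine ⟨_, (hδ.scomp v hl).const_mul ((a - 1) / a : ℂ), ?_⟩
  rw [gammaRatio_neg_one_mul ha hb0, gammaRatio_mul_eq ν ha hb0 hv, estFun]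
  simp only [Complex.real_smul]
  generalize (((b / a * v : ℝ) : ℂ) ^ ν / (cpoch (a - 1) (-ν) * cpoch b ν)) = q at *
  generalize incHyp (2 - a) b ((b / a * v : ℝ) : ℂ) ν = I at *
  have hs : (1 / b + v / a) * v * ((a - 1) / a * (((b / a : ℝ) : ℂ) * δ))
      + (1 - 1 / b - v * (1 - 2 / a)) * ((a - 1) / a * I)
      = (a - 1) / a / b * (((b / a * v : ℝ) : ℂ) * (1 + ((b / a * v : ℝ) : ℂ)) * δ
        + (b - 1 + (2 - a) * ((b / a * v : ℝ) : ℂ)) * I) := by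
    push_cast
    field_simp
    ring
  rw [hs, h]
  field_simp
  ring

/-- The truncated expansion satisfies the equation of the estimator up to small terms. -/
theorem hasDerivAt_lerchOp_sum (ν : ℂ) (a b : ℝ) (K : ℕ) {v : ℝ} (hv : 0 < v) :
    ∃ δ, HasDerivAt (fun v : ℝ => lerchOp ν v (∑ k ∈ Finset.range (K + 1), pPoly a b k)) δ v ∧
      (1 / b + v / a) * v * δ + (1 - 1 / b - v * (1 - 2 / a))
          * lerchOp ν v (∑ k ∈ Finset.range (K + 1), pPoly a b k)
        = (1 - 1 / b) * (∑ k ∈ Finset.range (K + 1), pPoly a b k).eval 0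
          - (1 + (ν - 1) / b) * ((∑ k ∈ Finset.range (K + 1), pPoly a b k).eval ν * (v : ℂ) ^ ν)
          + v * lerchOp ν v (defectPoly a b K) := by
  have hs := Complex.ofReal_mem_slitPlane.mpr hv
  have hvc : (v : ℂ) ≠ 0 := by exact_mod_cast hv.ne'
  have hrec := partialSum_recurrence a b K
  set S := ∑ k ∈ Finset.range (K + 1), pPoly a b k with hS
  refine ⟨_, (hasDerivAt_lerchOp ν S hs).comp_ofReal, ?_⟩
  -- The factor 1 + (X-1)/b is chosen so that shifting produces (1 + X/b) S(X+1), the left side of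
  -- the recurrence.
  have h := lerchOp_comp_X_add_one ν ((1 + C (1 / (b : ℂ)) * (X - 1)) * S) hs
  have hcomp : ((1 + C (1 / (b : ℂ)) * (X - 1)) * S).comp (X + 1)
      = S - C (1 / (a : ℂ)) * (X * S) - C (2 / (a : ℂ)) * S + defectPoly a b K := by
    rw [mul_comp, add_comp, mul_comp, sub_comp, X_comp, one_comp, C_comp, add_sub_cancel_right,
      hrec, show (2 / (a : ℂ)) = 1 / a * 2 by ring, C_mul, C_ofNat]
    ring
  have hQ : (1 + C (1 / (b : ℂ)) * (X - 1)) * S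
      = S + C (1 / (b : ℂ)) * (X * S) - C (1 / (b : ℂ)) * S := by ring
  rw [hcomp] at h
  simp only [eval_mul, eval_add, eval_sub, eval_one, eval_C, eval_X] at h
  rw [hQ] at h
  simp only [map_add, map_sub, lerchOp_C_mul] at h
  have hdiv : (v : ℂ) * (lerchOp ν v (X * S) / v) = lerchOp ν v (X * S) := mul_div_cancel₀ _ hvc
  rw [mul_assoc, hdiv]
  linear_combination -h

end

section

/-! ### Boundary behaviour and the main estimate -/

open Polynomial

theorem exists_lerchOp_sum_bound (ν : ℂ) (K : ℕ) :
    ∃ (C : ℝ) (A : ℕ), 0 ≤ C ∧ ∀ a b v : ℝ, 2 ≤ a → 2 ≤ b → 0 < v →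
      ‖lerchOp ν v (∑ k ∈ Finset.range (K + 1), pPoly a b k)‖ ≤ C * (v + v⁻¹) ^ A := by
  have h := fun k => exists_lerchOp_pPoly_bound ν k LinearMap.id
  choose C A hC hA using h
  refine ⟨∑ k ∈ Finset.range (K + 1), C k, ∑ k ∈ Finset.range (K + 1), A k,
    Finset.sum_nonneg fun k _ => hC k, fun a b v ha hb hv => ?_⟩
  rw [map_sum, Finset.sum_mul]
  refine (norm_sum_le _ _).trans (Finset.sum_le_sum fun k hk => ?_)
  have ha0 : 0 < a := by linarith
  have hb0 : 0 < b := by linarith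
  have e1 : 1 / a ≤ 1 / 2 := one_div_le_one_div_of_le two_pos ha
  have e2 : 1 / b ≤ 1 / 2 := one_div_le_one_div_of_le two_pos hb
  have h1 : (1 / a + 1 / b) ^ k ≤ 1 := pow_le_one₀ (by positivity) (by linarith)
  have hM := one_le_add_inv hv
  refine (hA k a b v ha0 hb0 hv).trans (mul_le_mul (mul_le_of_le_one_right (hC k) h1)
    (pow_le_pow_right₀ hM (Finset.single_le_sum (fun _ _ => Nat.zero_le _) hk))
    (by positivity) (hC k))

theorem tendsto_rpow_nhdsGT_zero {s : ℝ} (hs : 0 < s) :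
    Tendsto (fun v : ℝ => v ^ s) (𝓝[>] 0) (𝓝 0) := by
  have h := (Real.continuousAt_rpow_const 0 s (Or.inr hs.le)).tendsto
  rw [Real.zero_rpow hs.ne'] at h
  exact h.mono_left nhdsWithin_le_nhds

section Weight

variable {a b : ℝ}

theorem weight_le_of_pos (ha : 2 < a) (hb : 2 < b) {v : ℝ} (hv : 0 < v) :
    weight a b 0 v ≤ v ^ (b - 1) := by
  have ha0 : 0 < a := by linarith
  have hb0 : 0 < b := by linarith
  rw [weight, add_zero]
  refine mul_le_of_le_one_right (by positivity) ?_
  refine Real.rpow_le_one_of_one_le_of_nonpos ?_ (by linarith)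
  have : 0 < b / a * v := by positivity
  linarith

/-- The constant depends on a and b, which is enough for limits at fixed shape parameters. -/
theorem weight_le_const_mul (ha : 2 < a) (hb : 2 < b) {v : ℝ} (hv : 0 < v) :
    weight a b 0 v ≤ (b / a) ^ (3 - a - b) * v ^ (2 - a) := by
  have ha0 : 0 < a := by linarith
  have hb0 : 0 < b := by linarith
  have h1 : (1 + b / a * v) ^ (3 - a - b) ≤ (b / a * v) ^ (3 - a - b) :=
    Real.rpow_le_rpow_of_nonpos (by positivity) (by linarith) (by linarith)
  rw [weight, add_zero]
  refine (mul_le_mul_of_nonneg_left h1 (by positivity)).trans (le_of_eq ?_)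
  rw [Real.mul_rpow (by positivity) hv.le, mul_left_comm, ← Real.rpow_add hv]
  ring_nf

theorem tendsto_weight_smul_zero_of_bound (ha : 2 < a) {A : ℕ} (hb : (A + 2 : ℝ) < b) {C : ℝ}
    {f : ℝ → ℂ} (hf : ∀ v, 0 < v → ‖f v‖ ≤ C * (v + v⁻¹) ^ A) :
    Tendsto (fun v => weight a b 0 v • f v) (𝓝[>] 0) (𝓝 0) := by
  have hA : (0 : ℝ) ≤ A := A.cast_nonneg
  have hC : 0 ≤ C := by
    have h := (norm_nonneg _).trans (hf 1 one_pos)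
    by_contra hneg
    push Not at hneg
    have : C * (1 + (1 : ℝ)⁻¹) ^ A < 0 := mul_neg_of_neg_of_pos hneg (by positivity)
    linarith
  have h := (tendsto_rpow_nhdsGT_zero (s := b - 1 - A) (by linarith)).const_mul (C * 2 ^ A)
  rw [mul_zero] at h
  refine squeeze_zero_norm' ?_ h
  filter_upwards [Ioo_mem_nhdsGT one_pos] with v hv
  have hv0 : 0 < v := hv.1
  have hM : (v + v⁻¹) ^ A ≤ 2 ^ A * v ^ (-(A : ℝ)) := by
    rw [Real.rpow_neg hv0.le, Real.rpow_natCast, ← inv_pow, ← mul_pow]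
    refine pow_le_pow_left₀ (by positivity) ?_ A
    have := (one_le_inv₀ hv0).mpr hv.2.le
    linarith [hv.2]
  rw [norm_smul, Real.norm_of_nonneg (weight_pos (by linarith) (by linarith) 0 hv0).le]
  calc weight a b 0 v * ‖f v‖ ≤ v ^ (b - 1) * (C * (2 ^ A * v ^ (-(A : ℝ)))) :=
        mul_le_mul (weight_le_of_pos ha (by linarith) hv0)
          ((hf v hv0).trans (mul_le_mul_of_nonneg_left hM hC)) (norm_nonneg _) (by positivity)
    _ = C * 2 ^ A * v ^ (b - 1 - A) := by
        rw [sub_eq_add_neg (b - 1), Real.rpow_add hv0]; ring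

theorem tendsto_weight_smul_atTop_of_bound {A : ℕ} (ha : (A + 2 : ℝ) < a) (hb : 2 < b) {C : ℝ}
    {f : ℝ → ℂ} (hf : ∀ v, 0 < v → ‖f v‖ ≤ C * (v + v⁻¹) ^ A) :
    Tendsto (fun v => weight a b 0 v • f v) atTop (𝓝 0) := by
  have hA : (0 : ℝ) ≤ A := A.cast_nonneg
  have ha0 : 0 < a := by linarith
  have hb0 : 0 < b := by linarith
  have hC : 0 ≤ C := by
    have h := (norm_nonneg _).trans (hf 1 one_pos)
    by_contra hneg
    push Not at hneg
    have : C * (1 + (1 : ℝ)⁻¹) ^ A < 0 := mul_neg_of_neg_of_pos hneg (by positivity)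
    linarith
  have h := (tendsto_rpow_neg_atTop (y := a - 2 - A) (by linarith)).const_mul
    ((b / a) ^ (3 - a - b) * (C * 2 ^ A))
  rw [mul_zero] at h
  refine squeeze_zero_norm' ?_ h
  filter_upwards [eventually_ge_atTop 1] with v hv
  have hv0 : 0 < v := by linarith
  have hM : (v + v⁻¹) ^ A ≤ 2 ^ A * v ^ (A : ℝ) := by
    rw [Real.rpow_natCast, ← mul_pow]
    refine pow_le_pow_left₀ (by positivity) ?_ A
    have := inv_le_one_of_one_le₀ hv
    linarith
  rw [norm_smul, Real.norm_of_nonneg (weight_pos ha0 hb0 0 hv0).le]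
  calc weight a b 0 v * ‖f v‖
      ≤ (b / a) ^ (3 - a - b) * v ^ (2 - a) * (C * (2 ^ A * v ^ (A : ℝ))) :=
        mul_le_mul (weight_le_const_mul (by linarith) hb hv0)
          ((hf v hv0).trans (mul_le_mul_of_nonneg_left hM hC)) (norm_nonneg _) (by positivity)
    _ = (b / a) ^ (3 - a - b) * (C * 2 ^ A) * v ^ (-(a - 2 - A)) := by
        rw [show -(a - 2 - A) = (2 - a) + A by ring, Real.rpow_add hv0]; ring

theorem tendsto_weight_smul_estFun_atTop {ν : ℂ} (hb : 2 < b) (hbν : 2 < b + ν.re) (ha : 2 < a)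
    (haν : 2 < a - ν.re) :
    Tendsto (fun v => weight a b 0 v • estFun ν a b v) atTop (𝓝 0) := by
  have ha0 : 0 < a := by linarith
  have hb0 : 0 < b := by linarith
  have hl : Tendsto (fun v : ℝ => b / a * v) atTop atTop :=
    tendsto_id.const_mul_atTop (by positivity)
  have h := (((tendsto_incHyp_atTop hb hbν ha haν).comp hl).norm).const_mul
    ((b / a) ^ (3 - a - b) * (b / a) ^ (a - 2) * ‖((a - 1) / a : ℂ)‖)
  rw [norm_zero, mul_zero] at h
  refine squeeze_zero_norm' ?_ h
  filter_upwards [eventually_gt_atTop 0] with v hv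
  have hz : 0 < b / a * v := by positivity
  have hW := weight_pos ha0 hb0 0 hv
  rw [norm_smul, Real.norm_of_nonneg hW.le, estFun, norm_mul, Function.comp, norm_mul,
    Complex.norm_cpow_eq_rpow_re_of_pos hz]
  have he : (2 - a : ℂ).re = 2 - a := by simp
  rw [he, Real.mul_rpow (by positivity) hv.le]
  have h1 : (b / a) ^ (a - 2) * (b / a) ^ (2 - a) = 1 := by
    rw [← Real.rpow_add (by positivity)]; simp
  calc weight a b 0 v * (‖((a - 1) / a : ℂ)‖ * ‖incHyp (2 - a) b ((b / a * v : ℝ) : ℂ) ν‖)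
      ≤ (b / a) ^ (3 - a - b) * v ^ (2 - a)
        * (‖((a - 1) / a : ℂ)‖ * ‖incHyp (2 - a) b ((b / a * v : ℝ) : ℂ) ν‖) :=
        mul_le_mul_of_nonneg_right (weight_le_const_mul ha hb hv) (by positivity)
    _ = _ := by
      linear_combination -((b / a) ^ (3 - a - b) * v ^ (2 - a)
        * (‖((a - 1) / a : ℂ)‖ * ‖incHyp (2 - a) b ((b / a * v : ℝ) : ℂ) ν‖)) * h1

theorem tendsto_weight_smul_estFun_zero {ν : ℂ} (hb : 2 < b) (hbν : 2 < b + ν.re) (ha : 2 < a) :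
    Tendsto (fun v => weight a b 0 v • estFun ν a b v) (𝓝[>] 0) (𝓝 0) := by
  have ha0 : 0 < a := by linarith
  have hb0 : 0 < b := by linarith
  have hl : Tendsto (fun v : ℝ => b / a * v) (𝓝[>] 0) (𝓝 0) := by
    have : Continuous fun v : ℝ => b / a * v := by fun_prop
    have h := this.tendsto 0
    rw [mul_zero] at h
    exact h.mono_left nhdsWithin_le_nhds
  have h1 := (continuousAt_hyp2F1_neg_zero (b := 2 - a) (c := b) (by simpa using hb)).tendsto.comp hl
  have h2 := (continuousAt_hyp2F1_neg_zero (b := 2 - a + ν) (c := b + ν)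
    (by simpa using hbν)).tendsto.comp hl
  have w1 : Tendsto (fun v => ((weight a b 0 v : ℝ) : ℂ)) (𝓝[>] 0) (𝓝 0) := by
    refine squeeze_zero_norm' ?_ (tendsto_rpow_nhdsGT_zero (s := b - 1) (by linarith))
    filter_upwards [self_mem_nhdsWithin] with v hv
    rw [Complex.norm_real, Real.norm_of_nonneg (weight_pos ha0 hb0 0 hv).le]
    exact weight_le_of_pos ha hb hv
  have w2 : Tendsto (fun v => ((weight a b 0 v : ℝ) : ℂ) * ((b / a * v : ℝ) : ℂ) ^ ν)
      (𝓝[>] 0) (𝓝 0) := by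
    have h := (tendsto_rpow_nhdsGT_zero (s := b - 1 + ν.re) (by linarith)).const_mul
      ((b / a) ^ ν.re)
    rw [mul_zero] at h
    refine squeeze_zero_norm' ?_ h
    filter_upwards [self_mem_nhdsWithin] with v hv
    have hv0 : 0 < v := hv
    rw [norm_mul, Complex.norm_real, Real.norm_of_nonneg (weight_pos ha0 hb0 0 hv).le,
      Complex.norm_cpow_eq_rpow_re_of_pos (by positivity), Real.mul_rpow (by positivity) hv0.le,
      Real.rpow_add hv0, mul_left_comm]
    exact mul_le_mul_of_nonneg_left
      (mul_le_mul_of_nonneg_right (weight_le_of_pos ha hb hv) (by positivity)) (by positivity)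
  have h := ((w1.mul h1).sub ((w2.mul h2).const_mul
    (1 / (cpoch (a - 1) (-ν) * cpoch b ν)))).const_mul ((a - 1) / a : ℂ)
  simp only [zero_mul, mul_zero, sub_zero] at h
  refine h.congr fun v => ?_
  simp only [Function.comp, estFun, incHyp, Complex.real_smul]
  rw [show (1 : ℂ) - (2 - a) = a - 1 by ring]
  ring

end Weight

/-- The expansion with a possible loss of one order. -/
theorem estFun_sub_isBigO (ν : ℂ) (K : ℕ) {w : ℝ} (hw : 0 < w) :
    (fun p : ℝ × ℝ => estFun ν p.1 p.2 w
      - lerchOp ν w (∑ k ∈ Finset.range (K + 1), pPoly p.1 p.2 k))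
      =O[atTop ×ˢ atTop] fun p => (1 / p.1 + 1 / p.2) ^ K := by
  obtain ⟨C₀, hC₀, h0⟩ := (gammaRatio_mul_isBigO K 0).exists_nonneg
  obtain ⟨C₁, hC₁, h1⟩ := (gammaRatio_mul_isBigO K ν).exists_nonneg
  obtain ⟨C₂, A₂, hC₂, h2⟩ := exists_lerchOp_defectPoly_bound ν K
  obtain ⟨C₃, A₃, hC₃, h3⟩ := exists_lerchOp_sum_bound ν K
  obtain ⟨C₄, A₄, hC₄, h4⟩ := polyBdd_cpow ν
  -- A common growth exponent: A₂ + 1 for v times the defect, A₄ for v^ν, and A₃ so that the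
  -- condition on a and b also makes the truncated expansion vanish at both ends after weighting.
  set A := A₂ + 1 + A₃ + A₄ with hA
  set E := C₀ + (1 + ‖ν - 1‖) * (C₁ * C₄) + C₂ with hE
  have hE0 : 0 ≤ E := by positivity
  set B := max (max w w⁻¹) 2 with hB
  refine IsBigO.of_bound (2 ^ A * B ^ (A + 3) * E) ?_
  filter_upwards [h0.bound, h1.bound, eventually_le_le (4 * (A + 4 : ℝ)),
    eventually_le_le (|ν.re| + 3), eventually_scale_le_one] with p hp0 hp1 hpA hpν hε
  obtain ⟨a, b⟩ := p
  simp only at hp0 hp1 hpA hpν hε ⊢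
  have hAnn : (0 : ℝ) ≤ A := A.cast_nonneg
  have hA3 : (A₃ : ℝ) ≤ A := by rw [hA]; push_cast; linarith [(A₂.cast_nonneg : (0:ℝ) ≤ A₂),
    (A₄.cast_nonneg : (0:ℝ) ≤ A₄)]
  have ha : 2 < a := by linarith [hpA.1]
  have hb : 2 < b := by linarith [hpA.2]
  have hν1 := le_abs_self ν.re
  have hν2 := neg_abs_le ν.re
  have hbν : 2 < b + ν.re := by linarith [hpν.2]
  have haν : 2 < a - ν.re := by linarith [hpν.1]
  rw [norm_pow, Real.norm_of_nonneg hε.1.le] at hp0 hp1 ⊢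
  set ε := 1 / a + 1 / b with hεdef
  set S := ∑ k ∈ Finset.range (K + 1), pPoly a b k with hS
  set R : ℝ → ℂ := fun v =>
    (1 - 1 / b) * (gammaRatio a (-1 - 0) * gammaRatio b 0 - S.eval 0)
      - (1 + (ν - 1) / b) * ((gammaRatio a (-1 - ν) * gammaRatio b ν - S.eval ν) * (v : ℂ) ^ ν)
      - v * lerchOp ν v (defectPoly a b K) with hR
  have hode : ∀ v : ℝ, 0 < v → ∃ δ,
      HasDerivAt (fun v : ℝ => estFun ν a b v - lerchOp ν v S) δ v ∧
      (1 / b + v / a) * v * δ + (1 - 1 / b - v * (1 - 2 / a)) * (estFun ν a b v - lerchOp ν v S)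
        = R v := by
    intro v hv
    obtain ⟨δ₁, hδ₁, e₁⟩ := exists_hasDerivAt_estFun (ν := ν) (by linarith : 1 < a) hb hbν hv
    obtain ⟨δ₂, hδ₂, e₂⟩ := hasDerivAt_lerchOp_sum ν a b K hv
    refine ⟨δ₁ - δ₂, hδ₁.sub hδ₂, ?_⟩
    simp only [hR]
    linear_combination e₁ - e₂
  have hRb : ∀ v, 0 < v → ‖R v‖ ≤ E * ε ^ (K + 1) * (v + v⁻¹) ^ A := by
    intro v hv
    have hM := one_le_add_inv hv
    have hMA : ∀ n, n ≤ A → (v + v⁻¹) ^ n ≤ (v + v⁻¹) ^ A := fun n hn => pow_le_pow_right₀ hM hn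
    have c1 : ‖(1 - 1 / b : ℂ)‖ ≤ 1 := by
      have : (1 - 1 / b : ℂ) = ((1 - 1 / b : ℝ) : ℂ) := by push_cast; rfl
      rw [this, Complex.norm_real, Real.norm_eq_abs, abs_le]
      have e1 : 0 < 1 / b := by positivity
      have e2 : 1 / b ≤ 1 := by rw [div_le_one (by linarith)]; linarith
      constructor <;> linarith
    have c2 : ‖(1 + (ν - 1) / b : ℂ)‖ ≤ 1 + ‖ν - 1‖ := by
      refine (norm_add_le _ _).trans ?_
      rw [norm_one, norm_div, Complex.norm_real, Real.norm_of_nonneg (by linarith)]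
      gcongr
      exact div_le_self (norm_nonneg _) (by linarith)
    have t1 : ‖(1 - 1 / b : ℂ) * (gammaRatio a (-1 - 0) * gammaRatio b 0 - S.eval 0)‖
        ≤ C₀ * ε ^ (K + 1) * (v + v⁻¹) ^ A := by
      rw [norm_mul]
      calc _ ≤ 1 * (C₀ * ε ^ (K + 1)) := mul_le_mul c1 hp0 (norm_nonneg _) zero_le_one
        _ = C₀ * ε ^ (K + 1) * 1 := by ring
        _ ≤ _ := mul_le_mul_of_nonneg_left (one_le_pow₀ hM) (by positivity)
    have t2 : ‖(1 + (ν - 1) / b : ℂ) * ((gammaRatio a (-1 - ν) * gammaRatio b ν - S.eval ν)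
        * (v : ℂ) ^ ν)‖ ≤ (1 + ‖ν - 1‖) * (C₁ * C₄) * ε ^ (K + 1) * (v + v⁻¹) ^ A := by
      rw [norm_mul, norm_mul]
      calc _ ≤ (1 + ‖ν - 1‖) * (C₁ * ε ^ (K + 1) * (C₄ * (v + v⁻¹) ^ A)) := by
            refine mul_le_mul c2 (mul_le_mul hp1 ((h4 v hv).trans ?_) (norm_nonneg _)
              (by positivity)) (by positivity) (by positivity)
            exact mul_le_mul_of_nonneg_left (hMA A₄ (by omega)) hC₄
        _ = _ := by ring
    have t3 : ‖(v : ℂ) * lerchOp ν v (defectPoly a b K)‖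
        ≤ C₂ * ε ^ (K + 1) * (v + v⁻¹) ^ A := by
      rw [norm_mul, Complex.norm_real, Real.norm_of_nonneg hv.le]
      have hvM : v ≤ v + v⁻¹ := by have := inv_pos.mpr hv; linarith
      calc v * ‖lerchOp ν v (defectPoly a b K)‖
          ≤ (v + v⁻¹) * (C₂ * ε ^ (K + 1) * (v + v⁻¹) ^ A₂) :=
            mul_le_mul hvM (h2 a b v (by linarith) (by linarith) hv) (norm_nonneg _)
              (by positivity)
        _ = C₂ * ε ^ (K + 1) * (v + v⁻¹) ^ (A₂ + 1) := by ring
        _ ≤ _ := mul_le_mul_of_nonneg_left (hMA _ (by omega)) (by positivity)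
    calc ‖R v‖ ≤ _ := (norm_sub_le _ _).trans (add_le_add_left (norm_sub_le _ _) _)
      _ ≤ _ := add_le_add (add_le_add t1 t2) t3
      _ = E * ε ^ (K + 1) * (v + v⁻¹) ^ A := by rw [hE]; ring
  have hz : Tendsto (fun v => weight a b 0 v • (estFun ν a b v - lerchOp ν v S))
      (𝓝[>] 0) (𝓝 0) := by
    have h := (tendsto_weight_smul_estFun_zero hb hbν ha).sub
      (tendsto_weight_smul_zero_of_bound ha (A := A₃) (b := b) (by linarith [hpA.2])
        fun v hv => h3 a b v ha.le hb.le hv)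
    rw [sub_zero] at h
    simpa only [smul_sub] using h
  have hT : Tendsto (fun v => weight a b 0 v • (estFun ν a b v - lerchOp ν v S))
      atTop (𝓝 0) := by
    have h := (tendsto_weight_smul_estFun_atTop hb hbν ha haν).sub
      (tendsto_weight_smul_atTop_of_bound (a := a) (A := A₃) (by linarith [hpA.1]) hb
        fun v hv => h3 a b v ha.le hb.le hv)
    rw [sub_zero] at h
    simpa only [smul_sub] using h
  have hfin := norm_le_of_ode (B := B) hpA.1 hpA.2 (by positivity) hode hRb hz hT hw
    (le_max_right _ _) ((le_max_left _ _).trans (le_max_left _ _))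
    ((le_max_right _ _).trans (le_max_left _ _))
  refine hfin.trans (le_of_eq ?_)
  rw [← hεdef, pow_succ ε]
  have := hε.1.ne'
  field_simp

/-- The preceding estimate with K + 1 in place of K has the right order, and the extra term, of
order ε^(K+1) itself, may be moved into the error. -/
theorem estimator_sub_isBigO (ν : ℂ) {y₁ y₂ : ℝ} (h₁ : 0 < y₁) (h₂ : 0 < y₂) (K : ℕ) :
    (fun α : ℝ × ℝ => estimator ν α.1 α.2 y₁ y₂
        - ∑ k ∈ Finset.range (K + 1), expansionTerm ν α.1 α.2 y₁ y₂ k)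
      =O[atTop ×ˢ atTop] fun α : ℝ × ℝ => (1 / α.1 + 1 / α.2) ^ (K + 1) := by
  have hw : 0 < y₂ / y₁ := div_pos h₂ h₁
  obtain ⟨C, A, hC, hA⟩ := exists_lerchOp_pPoly_bound ν (K + 1) LinearMap.id
  have hlast : (fun p : ℝ × ℝ => lerchOp ν ((y₂ / y₁ : ℝ) : ℂ) (pPoly p.1 p.2 (K + 1)))
      =O[atTop ×ˢ atTop] fun p => (1 / p.1 + 1 / p.2) ^ (K + 1) := by
    refine IsBigO.of_bound (C * (y₂ / y₁ + (y₂ / y₁)⁻¹) ^ A) ?_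
    filter_upwards [eventually_le_le 1, eventually_scale_le_one] with p hp hε
    have h := hA p.1 p.2 (y₂ / y₁) (by linarith [hp.1]) (by linarith [hp.2]) hw
    rw [norm_pow, Real.norm_of_nonneg hε.1.le]
    refine h.trans (le_of_eq (by ring))
  refine (((estFun_sub_isBigO ν (K + 1) hw).add hlast).const_mul_left (1 / (y₁ : ℂ))).congr_left
    fun p => ?_
  rw [estimator_eq, Finset.sum_congr rfl fun k _ => expansionTerm_eq ν p.1 p.2 h₁ h₂ k,
    ← Finset.mul_sum, ← map_sum, Finset.sum_range_succ _ (K + 1), map_add]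
  ring

end

end GenEstimator

end

theorem mainTheorem10 :
    (∀ (α₁ α₂ : ℝ), 0 < α₁ → 0 < α₂ → ∀ (k : ℕ) (x : ℂ),
      GenEstimator.P α₁ α₂ k x
        = ∑ ℓ ∈ Finset.range (2 * k + 1), GenEstimator.pCoeff α₁ α₂ k ℓ * x ^ ℓ) ∧
    (∀ (ν : ℂ) (y₁ y₂ : ℝ), 0 < y₁ → 0 < y₂ → ∀ K : ℕ,
      (fun α : ℝ × ℝ => GenEstimator.estimator ν α.1 α.2 y₁ y₂
          - ∑ k ∈ Finset.range (K + 1), GenEstimator.expansionTerm ν α.1 α.2 y₁ y₂ k)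
        =O[atTop ×ˢ atTop] fun α : ℝ × ℝ => (1 / α.1 + 1 / α.2) ^ (K + 1)) ∧
    (∀ (n : ℕ) (α₁ α₂ y₁ y₂ : ℝ), 1 ≤ n → 0 < α₁ → 0 < α₂ → 0 < y₁ → 0 < y₂ →
      (n : ℝ) - 2 < α₂ →
      Summable fun k : ℕ => ‖GenEstimator.expansionTerm (n : ℂ) α₁ α₂ y₁ y₂ k‖) :=
  ⟨fun α₁ α₂ _ _ k x => GenEstimator.P_eq_sum α₁ α₂ k x,
    fun ν _ _ h₁ h₂ K => GenEstimator.estimator_sub_isBigO ν h₁ h₂ K,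
    fun n α₁ α₂ y₁ y₂ _ _ h₂ hy₁ hy₂ h =>
      GenEstimator.summable_expansionTerm n α₁ α₂ y₁ y₂ h₂ hy₁ hy₂ h⟩
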